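/- Conventions. A countable Borel equivalence relation (CBER) $E$ on a standard Borel space $X$ is an equivalence relation that is a Borel subset of $X^2$ and all of whose classes are countable. $\mathrm{Aut}_B(E)$ is the group of Borel automorphisms $T$ of $X$ with $x\mathrel{E}y\iff T(x)\mathrel{E}T(y)$; $\mathrm{Inn}_B(E)$ is its normal subgroup of those $T$ with $x\mathrel{E}T(x)$ for all $x\in X$; $\mathrm{Out}_B(E)=\mathrm{Aut}_B(E)/\mathrm{Inn}_B(E)$, with quotient map $p_E:\mathrm{Aut}_B(E)\to\mathrm{Out}_B(E)$. An outer action of a group $G$ is a homomorphism $\beta:G\to\mathrm{Out}_B(E)$, where $E$ is a CBER on a standard Borel space. A lift of $\beta$ is a homomorphism $\alpha:G\to\mathrm{Aut}_B(E)$ with $p_E\circ\alpha=\beta$. A homomorphism $\alpha:G\to\mathrm{Aut}_B(E)$ is class-bijective if for all $g\in G$ and $x\in X$, $\alpha(g)(x)\mathrel{E}x$ implies $\alpha(g)(x)=x$. A homomorphism $f:H\to G$ of countable groups has the class-bijective lifting property if for every CBER $E$ on a standard Borel space, every class-bijective homomorphism $\gamma:H\to\mathrm{Aut}_B(E)$ and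 every homomorphism $\beta:G\to\mathrm{Out}_B(E)$ with $p_E\circ\gamma=\beta\circ f$, there is a class-bijective homomorphism $\alpha:G\to\mathrm{Aut}_B(E)$ with $\alpha\circ f=\gamma$ and $p_E\circ\alpha=\beta$. Theorem. Let $G$ be a countable group and let $N\trianglelefteq G$ be a finite normal subgroup such that every outer action of $G/N$ has a class-bijective lift. Then (1) the inclusion $N\hookrightarrow G$ has the class-bijective lifting property; (2) every outer action of $G$ has a class-bijective lift. -/

import Mathlib

universe u v w

/-- A countable Borel equivalence relation on `X`: an equivalence relation which is a Borel subset
of `X × X` and all of whose classes are countable. -/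
structure CBER (X : Type*) [MeasurableSpace X] extends Setoid X where
  borel : MeasurableSet {p : X × X | toSetoid p.1 p.2}
  countable_classes : ∀ x : X, {y : X | toSetoid x y}.Countable

namespace CBER

variable {X : Type*} [MeasurableSpace X]

/-- `Aut_B(E)`: the group of Borel automorphisms `T` of `X` with `x E y ↔ T x E T y`. -/
def Aut (E : CBER X) : Subgroup (Equiv.Perm X) where
  carrier := {T | Measurable T ∧ Measurable T.symm ∧
    ∀ x y : X, E.toSetoid x y ↔ E.toSetoid (T x) (T y)}
  one_mem' := ⟨measurable_id, measurable_id, fun _ _ => Iff.rfl⟩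
  mul_mem' := by
    rintro S T ⟨hS, hS', hSE⟩ ⟨hT, hT', hTE⟩
    exact ⟨hS.comp hT, hT'.comp hS', fun x y => (hTE x y).trans (hSE (T x) (T y))⟩
  inv_mem' := by
    rintro T ⟨hT, hT', hTE⟩
    refine ⟨hT', hT, fun x y => ?_⟩
    have h := hTE (T.symm x) (T.symm y)
    rw [T.apply_symm_apply, T.apply_symm_apply] at h
    exact h.symm

/-- `Inn_B(E)`: the full group of `E`, consisting of the `T` in `Aut_B(E)` with `x E T x` for
all `x`. -/
def Inn (E : CBER X) : Subgroup E.Aut where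
  carrier := {T | ∀ x : X, E.toSetoid x (T.1 x)}
  one_mem' := fun x => E.toSetoid.refl x
  mul_mem' := by
    intro S T hS hT x
    exact E.toSetoid.trans (hT x) (hS (T.1 x))
  inv_mem' := by
    intro T hT x
    have h := hT (T.1.symm x)
    rw [T.1.apply_symm_apply] at h
    exact E.toSetoid.symm h

instance inn_normal (E : CBER X) : E.Inn.Normal where
  conj_mem := by
    intro T hT S x
    have h := (S.2.2.2 _ _).1 (hT (S.1.symm x))
    rw [S.1.apply_symm_apply] at h
    exact h

/-- `Out_B(E) = Aut_B(E) / Inn_B(E)`. -/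
abbrev Out (E : CBER X) : Type _ := E.Aut ⧸ E.Inn

/-- The quotient map `p_E : Aut_B(E) → Out_B(E)`. -/
def toOut (E : CBER X) : E.Aut →* E.Out := QuotientGroup.mk' E.Inn

/-- An action of `G` on `X` by Borel automorphisms of `E` is class-bijective if
`g • x E x` implies `g • x = x`, i.e. `X → X / E` is injective on every `G`-orbit. -/
def IsClassBijective {G : Type*} [Group G] (E : CBER X) (a : G →* E.Aut) : Prop :=
  ∀ (g : G) (x : X), E.toSetoid ((a g).1 x) x → (a g).1 x = x

/-- `a : G → Aut_B(E)` is a lift of the outer action `b : G → Out_B(E)`. -/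
def IsLift {G : Type*} [Group G] (E : CBER X) (a : G →* E.Aut) (b : G →* E.Out) : Prop :=
  E.toOut.comp a = b

end CBER

/-- Every outer action of `G` (on the quotient of any standard Borel space by any countable Borel
equivalence relation) has a class-bijective lift. -/
def EveryOuterActionHasClassBijectiveLift (G : Type v) [Group G] : Prop :=
  ∀ (X : Type u) [MeasurableSpace X] [StandardBorelSpace X] (E : CBER X) (b : G →* E.Out),
    ∃ a : G →* E.Aut, E.IsLift a b ∧ E.IsClassBijective a

/-- The class-bijective lifting property of `f : H → G`: for every commutative square formed by `f`,
a class-bijective `c : H → Aut_B(E)`, `b : G → Out_B(E)` and `p_E`, there is a class-bijective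
diagonal `a : G → Aut_B(E)` making both triangles commute. -/
def HasClassBijectiveLiftingProperty {H : Type v} {G : Type w} [Group H] [Group G]
    (f : H →* G) : Prop :=
  ∀ (X : Type u) [MeasurableSpace X] [StandardBorelSpace X] (E : CBER X)
    (c : H →* E.Aut) (b : G →* E.Out),
    E.toOut.comp c = b.comp f → E.IsClassBijective c →
      ∃ a : G →* E.Aut, a.comp f = c ∧ E.IsLift a b ∧ E.IsClassBijective a

/-! Part (2) follows from (1) once outer actions of the finite group `N` are known to lift: lift the
restriction to `N` class-bijectively, then extend that lift to `G` by (1).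

For (1), let `F` be the join of `E` with the `N`-orbits. Since the given action of `N` is
class-bijective, every `N`-orbit meets every `E`-class inside its `F`-class in exactly one point, so
a point is determined by its `E`-class and its `N`-orbit. The outer action says how classes move. If
an action on the Borel set `Y` of orbit representatives says how orbits move, the two together
define the action on `X`. The action on `Y` comes from the hypothesis on `G ⧸ N`, applied to `F`
restricted to `Y`. This requires, for each `g`, a Borel automorphism of `Y` inducing the permutation
of `F`-classes given by `g`, although a Borel representative `t g` on `X` need not respect
`N`-orbits.

The remedy is cancellation, `exists_bijective_matching`. The maps sending `x` to the orbit of `x`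
and to the orbit of `t g x` are two surjections of `X` onto `Y` with fibres of bounded size, and `E`
relates a point of `X` to exactly one point of each fibre over the same base point. A maximal Borel
matching compares the two targets. Wherever it leaves points over on one side, it yields an
injective, non-surjective self-map of the part of `X` over that base point. Iterating this map
produces infinitely many disjoint copies, which absorb anything with countable fibres
(`exists_absorbing_matching`), and Schröder–Bernstein finishes.

Compression also handles finite groups (`CBER.exists_classBijective_lift_of_finite`). Take a maximal
Borel family of disjoint transversals of the outer orbits. Orbits that it partitions carry an
evident lift. In any other orbit one class is fully covered and another is not, which compresses the
classes. There `X` is isomorphic over `X / E` to a space of pairs (point `x`, class `g[x]`), on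
which the group acts visibly.

The Borel selections rest on Lusin–Novikov. The base of a matching is a bare set with no σ-algebra,
so Borelness is always stated for preimages. -/

open Set MeasureTheory

/-! ### The Lusin–Novikov theorem -/

/-- `S` is covered by countably many measurable sets on which `p` is injective. -/
def SigmaInjOn {C X : Type*} [MeasurableSpace C] (p : C → X) (S : Set C) : Prop :=
  ∃ f : ℕ → Set C, (∀ n, MeasurableSet (f n) ∧ InjOn p (f n)) ∧ S ⊆ ⋃ n, f n

theorem SigmaInjOn.mono {C X : Type*} [MeasurableSpace C] {p : C → X} {S T : Set C}
    (hT : SigmaInjOn p T) (h : S ⊆ T) : SigmaInjOn p S := by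
  obtain ⟨f, hf, hc⟩ := hT
  exact ⟨f, hf, h.trans hc⟩

theorem SigmaInjOn.of_injOn {C X : Type*} [MeasurableSpace C] {p : C → X} {S : Set C}
    (hS : MeasurableSet S) (h : InjOn p S) : SigmaInjOn p S :=
  ⟨fun _ => S, fun _ => ⟨hS, h⟩, fun _ hx => mem_iUnion.2 ⟨0, hx⟩⟩

theorem SigmaInjOn.iUnion {C X ι : Type*} [Countable ι] [MeasurableSpace C] {p : C → X}
    {S : ι → Set C} (h : ∀ i, SigmaInjOn p (S i)) : SigmaInjOn p (⋃ i, S i) := by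
  choose f hf hc using h
  rcases isEmpty_or_nonempty ι with hι | hι
  · exact ⟨fun _ => ∅, fun _ => ⟨MeasurableSet.empty, injOn_empty _⟩, by simp⟩
  obtain ⟨e, he⟩ := exists_surjective_nat (ι × ℕ)
  refine ⟨fun n => f (e n).1 (e n).2, fun n => hf _ _, ?_⟩
  intro x hx
  obtain ⟨i, hi⟩ := mem_iUnion.1 hx
  obtain ⟨k, hk⟩ := mem_iUnion.1 (hc i hi)
  obtain ⟨n, hn⟩ := he (i, k)
  exact mem_iUnion.2 ⟨n, by simpa [hn] using hk⟩

theorem SigmaInjOn.union {C X : Type*} [MeasurableSpace C] {p : C → X}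
    {S T : Set C} (hS : SigmaInjOn p S) (hT : SigmaInjOn p T) : SigmaInjOn p (S ∪ T) := by
  rw [union_eq_iUnion]
  exact SigmaInjOn.iUnion (by rintro (_ | _) <;> assumption)

/-! ### Separation of analytic sets and doubling of fibre tuples -/

section LusinNovikov

variable {C X : Type*} [TopologicalSpace C] [PolishSpace C] [MeasurableSpace C] [BorelSpace C]
  [TopologicalSpace X] [T2Space X] {p : C → X}

/-- A set disjoint from the `p`-neighbours of a measurably parametrized set can be enlarged to a
measurable such set. -/
theorem exists_measurableSet_no_neighbours {D D' : Type*} [MeasurableSpace D]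
    [StandardBorelSpace D] [MeasurableSpace D'] [StandardBorelSpace D']
    (hp : Continuous p) {B : Set D} (hB : MeasurableSet B) {f : D → C} (hf : Measurable f)
    {B' : Set D'} (hB' : MeasurableSet B') {f' : D' → C} (hf' : Measurable f')
    (h : ∀ a ∈ f' '' B', ∀ b ∈ f '' B, p a = p b → a = b) :
    ∃ u, f '' B ⊆ u ∧ MeasurableSet u ∧ ∀ a ∈ f' '' B', ∀ b ∈ u, p a = p b → a = b := by
  have hR : MeasurableSet {q : C × C | p q.1 = p q.2 ∧ q.1 ≠ q.2} := by
    apply MeasurableSet.inter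
    · exact (isClosed_eq (hp.comp continuous_fst) (hp.comp continuous_snd)).measurableSet
    · exact (isClosed_eq continuous_fst continuous_snd).measurableSet.compl
  have hA : AnalyticSet (f '' B) := hB.analyticSet_image hf
  -- The set of proper `p`-neighbours of the second image is analytic, being a projection of a Borel
  -- set; Lusin separation keeps `u` away from it.
  have hN : AnalyticSet ((fun q : D' × C => q.2) ''
      {q : D' × C | q.1 ∈ B' ∧ (p (f' q.1) = p q.2 ∧ f' q.1 ≠ q.2)}) := by
    refine MeasurableSet.analyticSet_image ?_ measurable_snd
    exact (measurable_fst hB').inter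
      (((hf'.comp measurable_fst).prodMk measurable_snd) hR)
  obtain ⟨u, hu, hd, hm⟩ := hA.measurablySeparable hN (by
    rw [Set.disjoint_left]
    rintro b hb ⟨⟨d, b'⟩, ⟨hd, h1, h2⟩, rfl⟩
    exact h2 (h _ ⟨d, hd, rfl⟩ _ hb h1))
  refine ⟨u, hu, hm, ?_⟩
  rintro _ ⟨d, hdB, rfl⟩ b hb hpab
  by_contra hne
  exact Set.disjoint_left.1 hd ⟨⟨d, b⟩, ⟨hdB, hpab, hne⟩, rfl⟩ hb

/-- A measurably parametrized set on which `p` is injective can be enlarged to a measurable such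
set. -/
theorem exists_measurableSet_injOn_of_image {D : Type*} [MeasurableSpace D] [StandardBorelSpace D]
    (hp : Continuous p) {B : Set D} (hB : MeasurableSet B) {f : D → C} (hf : Measurable f)
    (hinj : InjOn p (f '' B)) : ∃ S, MeasurableSet S ∧ InjOn p S ∧ f '' B ⊆ S := by
  -- Separate twice: `u` has no proper neighbour in the image, hence the image has none in `u`, and
  -- can be enlarged to a `v` that has none in `u`. Injectivity then holds on `u ∩ v`.
  obtain ⟨u, hu, hum, hu'⟩ := exists_measurableSet_no_neighbours hp hB hf hB hf
    (fun a ha b hb h => hinj ha hb h)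
  obtain ⟨v, hv, hvm, hv'⟩ := exists_measurableSet_no_neighbours hp hB hf (f' := id) hum
    measurable_id (by
      rw [image_id]
      exact fun a ha b hb h => (hu' b hb a ha h.symm).symm)
  rw [image_id] at hv'
  exact ⟨u ∩ v, hum.inter hvm, fun a ha b hb h => hv' a ha.1 b hb.2 h, subset_inter hu hv⟩

/-- Tuples in a single fibre of `p` whose coordinates lie in the sets `U i`. -/
def fiberBox {C X ι : Type*} (p : C → X) (U : ι → Set C) : Set (ι → C) :=
  {a | (∀ i j, p (a i) = p (a j)) ∧ ∀ i, a i ∈ U i}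

/-- Every tuple in `A` has a coordinate in a fixed measurable set which is covered by countably
many measurable sets on which `p` is injective. -/
def HitSmall {C X ι : Type*} [MeasurableSpace C] (p : C → X) (A : Set (ι → C)) : Prop :=
  ∃ S, MeasurableSet S ∧ SigmaInjOn p S ∧ ∀ a ∈ A, ∃ i, a i ∈ S

theorem HitSmall.iUnion {C X ι κ : Type*} [Countable κ] [MeasurableSpace C] {p : C → X}
    {A : κ → Set (ι → C)} (h : ∀ k, HitSmall p (A k)) : HitSmall p (⋃ k, A k) := by
  choose S hS hS' hA using h
  refine ⟨⋃ k, S k, MeasurableSet.iUnion hS, SigmaInjOn.iUnion hS', ?_⟩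
  intro a ha
  obtain ⟨k, hk⟩ := mem_iUnion.1 ha
  obtain ⟨i, hi⟩ := hA k a hk
  exact ⟨i, mem_iUnion.2 ⟨k, hi⟩⟩

theorem HitSmall.mono {C X ι : Type*} [MeasurableSpace C] {p : C → X}
    {A B : Set (ι → C)} (h : HitSmall p B) (hAB : A ⊆ B) : HitSmall p A := by
  obtain ⟨S, h1, h2, h3⟩ := h
  exact ⟨S, h1, h2, fun a ha => h3 a (hAB ha)⟩

/-- If a box of fibre tuples is not small, neither is the set of doubled tuples whose two halves
differ at all coordinates in a finite set. -/
theorem not_hitSmall_double {ι : Type*} [Finite ι] (hp : Continuous p) {U : ι → Set C}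
    (hU : ∀ i, MeasurableSet (U i)) (h : ¬ HitSmall p (fiberBox p U)) (J : Finset ι) :
    ¬ HitSmall p {a : ι × Bool → C | a ∈ fiberBox p (fun k : ι × Bool => U k.1) ∧
      ∀ i ∈ J, a (i, false) ≠ a (i, true)} := by
  classical
  induction J using Finset.induction_on with
  | empty =>
    rintro ⟨S, hS, hS', hA⟩
    refine h ⟨S, hS, hS', fun a ha => ?_⟩
    obtain ⟨k, hk⟩ := hA (fun k => a k.1) ⟨⟨fun _ _ => ha.1 _ _, fun _ => ha.2 _⟩, by simp⟩
    exact ⟨k.1, hk⟩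
  | insert j J hj ih =>
    rintro ⟨S, hS, hS', hA⟩
    apply ih
    -- `B` collects the tuples missed by `S`. It suffices that their `(j, false)` coordinates form a
    -- set on which `p` is injective, since such a set can be added to `S`.
    set B : Set (ι × Bool → C) := {a | (a ∈ fiberBox p (fun k : ι × Bool => U k.1) ∧
      ∀ i ∈ J, a (i, false) ≠ a (i, true)) ∧ ∀ k, a k ∉ S} with hBdef
    have hBm : MeasurableSet B := by
      have e1 : ∀ k l : ι × Bool, MeasurableSet {a : ι × Bool → C | p (a k) = p (a l)} := fun k l =>
        (isClosed_eq (hp.comp (continuous_apply k)) (hp.comp (continuous_apply l))).measurableSet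
      have e2 : ∀ k l : ι × Bool, MeasurableSet {a : ι × Bool → C | a k ≠ a l} := fun k l =>
        (isClosed_eq (continuous_apply k) (continuous_apply l)).measurableSet.compl
      refine MeasurableSet.inter (MeasurableSet.inter (MeasurableSet.inter ?_ ?_) ?_) ?_
      · show MeasurableSet {a : ι × Bool → C | ∀ i j, p (a i) = p (a j)}
        simp only [ofPred_forall]
        exact MeasurableSet.iInter fun _ => MeasurableSet.iInter fun _ => e1 _ _
      · show MeasurableSet {a : ι × Bool → C | ∀ i, a i ∈ U i.1}
        simp only [ofPred_forall]
        exact MeasurableSet.iInter fun k => measurable_pi_apply k (hU k.1)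
      · show MeasurableSet {a : ι × Bool → C | ∀ i ∈ J, a (i, false) ≠ a (i, true)}
        simp only [ofPred_forall]
        exact MeasurableSet.iInter fun _ => MeasurableSet.iInter fun _ => e2 _ _
      · show MeasurableSet {a : ι × Bool → C | ∀ k, a k ∉ S}
        simp only [ofPred_forall]
        refine MeasurableSet.iInter fun k => ?_
        exact (measurable_pi_apply (X := fun _ : ι × Bool => C) k hS).compl
    have hinj : InjOn p ((fun a : ι × Bool → C => a (j, false)) '' B) := by
      rintro _ ⟨a, ha, rfl⟩ _ ⟨b, hb, rfl⟩ hab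
      by_contra hne
      simp only at hab hne
      -- If two tuples of `B` had distinct `(j, false)` coordinates in one fibre, transplanting one
      -- of these into slot `(j, true)` of the other tuple would give a tuple split at `j` that
      -- still avoids `S`.
      have hmem : Function.update a (j, true) (b (j, false)) ∈
          {a : ι × Bool → C | a ∈ fiberBox p (fun k : ι × Bool => U k.1) ∧
            ∀ i ∈ insert j J, a (i, false) ≠ a (i, true)} := by
        refine ⟨⟨?_, fun k => ?_⟩, fun i hi => ?_⟩
        · have : ∀ k, p (Function.update a (j, true) (b (j, false)) k) = p (a (j, false)) := by
            intro k
            by_cases hkj : k = (j, true)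
            · subst hkj
              rw [Function.update_self, hab]
            · rw [Function.update_of_ne hkj]
              exact ha.1.1.1 _ _
          intro k l
          rw [this k, this l]
        · by_cases hkj : k = (j, true)
          · subst hkj
            rw [Function.update_self]
            exact hb.1.1.2 (j, false)
          · rw [Function.update_of_ne hkj]
            exact ha.1.1.2 k
        · rw [Function.update_of_ne (by simp)]
          by_cases hij : i = j
          · subst hij
            rwa [Function.update_self]
          · rw [Function.update_of_ne (by simpa using hij)]
            exact ha.1.2 i ((Finset.mem_insert.1 hi).resolve_left hij)
      obtain ⟨k, hk⟩ := hA _ hmem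
      by_cases hkj : k = (j, true)
      · subst hkj
        rw [Function.update_self] at hk
        exact hb.2 _ hk
      · rw [Function.update_of_ne hkj] at hk
        exact ha.2 _ hk
    obtain ⟨T, hT, hTi, hTB⟩ := exists_measurableSet_injOn_of_image hp hBm
      (measurable_pi_apply (j, false)) hinj
    refine ⟨S ∪ T, hS.union hT, hS'.union (SigmaInjOn.of_injOn hT hTi), fun a ha => ?_⟩
    by_cases hk : ∃ k, a k ∈ S
    · obtain ⟨k, hk⟩ := hk
      exact ⟨k, Or.inl hk⟩
    · push Not at hk
      exact ⟨(j, false), Or.inr (hTB ⟨a, ⟨ha, hk⟩, rfl⟩)⟩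

end LusinNovikov

/-! ### A Cantor set inside a single fibre -/

section CantorScheme

variable {C X : Type*} [MetricSpace C] [CompleteSpace C] [SecondCountableTopology C]
  [MeasurableSpace C] [BorelSpace C] [TopologicalSpace X] [T2Space X] {p : C → X}

/-- Splitting every set of a box of open sets into two small, disjoint open sets. -/
theorem exists_split_fiberBox {ι : Type*} [Finite ι] (hp : Continuous p) {U : ι → Set C}
    (hU : ∀ i, IsOpen (U i)) (h : ¬ HitSmall p (fiberBox p U)) {ε : ℝ} (hε : 0 < ε) :
    ∃ V : ι × Bool → Set C, (∀ k, IsOpen (V k)) ∧ (∀ k, closure (V k) ⊆ U k.1) ∧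
      (∀ k, ∀ x ∈ V k, ∀ y ∈ V k, dist x y ≤ ε) ∧
      (∀ i, Disjoint (V (i, false)) (V (i, true))) ∧ ¬ HitSmall p (fiberBox p V) := by
  classical
  have := Fintype.ofFinite ι
  have hd := not_hitSmall_double hp (fun i => (hU i).measurableSet) h Finset.univ
  by_contra hcon
  push Not at hcon
  apply hd
  -- There are only countably many admissible boxes of basic open sets, and they cover all tuples
  -- with distinct halves; if all were small, the doubled set would be small as well.
  let K := {V : ι × Bool → TopologicalSpace.countableBasis C //
    (∀ k, closure (V k : Set C) ⊆ U k.1) ∧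
      (∀ k, ∀ x ∈ (V k : Set C), ∀ y ∈ (V k : Set C), dist x y ≤ ε) ∧
      (∀ i, Disjoint (V (i, false) : Set C) (V (i, true)))}
  have hK : ∀ V : K, HitSmall p (fiberBox p (fun k => (V.1 k : Set C))) := fun V =>
    hcon _ (fun k => TopologicalSpace.isOpen_of_mem_countableBasis (V.1 k).2) V.2.1 V.2.2.1 V.2.2.2
  have : Countable (TopologicalSpace.countableBasis C) :=
    (TopologicalSpace.countable_countableBasis C).to_subtype
  refine (HitSmall.iUnion hK).mono ?_
  rintro a ⟨ha, hne⟩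
  have hr : ∀ k : ι × Bool, ∃ r > 0, r ≤ ε / 2 ∧ Metric.closedBall (a k) r ⊆ U k.1 ∧
      r ≤ dist (a (k.1, false)) (a (k.1, true)) / 2 := by
    intro k
    obtain ⟨r, hr, hrU⟩ := Metric.nhds_basis_closedBall.mem_iff.1 ((hU k.1).mem_nhds (ha.2 k))
    have hpos : 0 < dist (a (k.1, false)) (a (k.1, true)) :=
      dist_pos.2 (hne k.1 (Finset.mem_univ _))
    refine ⟨min r (min (ε / 2) (dist (a (k.1, false)) (a (k.1, true)) / 2)), by positivity,
      (min_le_right _ _).trans (min_le_left _ _), ?_, (min_le_right _ _).trans (min_le_right _ _)⟩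
    exact (Metric.closedBall_subset_closedBall (min_le_left _ _)).trans hrU
  choose r hr0 hrε hrU hrd using hr
  have hV : ∀ k, ∃ V ∈ TopologicalSpace.countableBasis C, a k ∈ V ∧ V ⊆ Metric.ball (a k) (r k) :=
    fun k => (TopologicalSpace.isBasis_countableBasis C).mem_nhds_iff.1
      (Metric.ball_mem_nhds _ (hr0 k))
  choose V hVb haV hVr using hV
  refine mem_iUnion.2 ⟨⟨fun k => ⟨V k, hVb k⟩, fun k => ?_, fun k x hx y hy => ?_, fun i => ?_⟩,
    ha.1, haV⟩
  · exact (closure_mono (hVr k)).trans (Metric.closure_ball_subset_closedBall.trans (hrU k))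
  · have h1 := hVr k hx
    have h2 := hVr k hy
    rw [Metric.mem_ball] at h1 h2
    have := dist_triangle_right x y (a k)
    linarith [hrε k]
  · rw [Set.disjoint_left]
    intro x hx hy
    have h1 := hVr _ hx
    have h2 := hVr _ hy
    rw [Metric.mem_ball] at h1 h2
    have := dist_triangle_left (a (i, false)) (a (i, true)) x
    linarith [hrd (i, false), hrd (i, true)]

/-- A continuous map with countable fibres has a countable measurable decomposition of its domain
into pieces on which it is injective. -/
theorem sigmaInjOn_univ_of_continuous (hp : Continuous p) (hc : ∀ x, (p ⁻¹' {x}).Countable) :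
    SigmaInjOn p univ := by
  classical
  by_contra hbad
  let St : ℕ → Type _ := fun n => {U : (Fin n → Bool) → Set C //
    (∀ s, IsOpen (U s)) ∧ ¬ HitSmall p (fiberBox p U)}
  have step : ∀ n (U : St n), ∃ V : St (n + 1),
      (∀ s : Fin (n + 1) → Bool, closure (V.1 s) ⊆ U.1 (fun i => s i.castSucc)) ∧
      (∀ s, ∀ x ∈ V.1 s, ∀ y ∈ V.1 s, dist x y ≤ (1 / 2 : ℝ) ^ n) ∧
      (∀ s t : Fin (n + 1) → Bool, (∀ i : Fin n, s i.castSucc = t i.castSucc) →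
        s (Fin.last n) ≠ t (Fin.last n) → Disjoint (V.1 s) (V.1 t)) := by
    rintro n ⟨U, hU, hUs⟩
    obtain ⟨V, hV1, hV2, hV3, hV4, hV5⟩ := exists_split_fiberBox hp hU hUs
      (ε := (1 / 2 : ℝ) ^ n) (by positivity)
    refine ⟨⟨fun s => V (fun i => s i.castSucc, s (Fin.last n)), fun s => hV1 _, ?_⟩,
      fun s => hV2 _, fun s => hV3 _, ?_⟩
    · rintro ⟨S, hS, hS', hA⟩
      refine hV5 ⟨S, hS, hS', fun a ha => ?_⟩
      obtain ⟨s, hs⟩ := hA (fun s => a (fun i => s i.castSucc, s (Fin.last n)))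
        ⟨fun _ _ => ha.1 _ _, fun _ => ha.2 _⟩
      exact ⟨_, hs⟩
    · intro s t hst hlast
      have hst' : (fun i : Fin n => s i.castSucc) = fun i : Fin n => t i.castSucc := funext hst
      simp only [hst']
      rcases hs : s (Fin.last n) <;> rcases ht : t (Fin.last n)
      · simp_all
      · exact hV4 _
      · exact (hV4 _).symm
      · simp_all
  choose next hn1 hn2 hn3 using step
  let U0 : St 0 := ⟨fun _ => univ, fun _ => isOpen_univ, by
    rintro ⟨S, hS, hS', hA⟩
    refine hbad (hS'.mono fun x _ => ?_)
    obtain ⟨_, hi⟩ := hA (fun _ => x) ⟨fun _ _ => rfl, fun _ => mem_univ _⟩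
    exact hi⟩
  let U : ∀ n, St n := fun n => Nat.rec U0 (fun n u => next n u) n
  have hne : ∀ n, (fiberBox p (U n).1).Nonempty := by
    intro n
    by_contra hemp
    rw [not_nonempty_iff_eq_empty] at hemp
    refine (U n).2.2 ⟨∅, MeasurableSet.empty, ?_, by simp [hemp]⟩
    exact SigmaInjOn.of_injOn MeasurableSet.empty (injOn_empty _)
  choose t ht using hne
  let res : (ℕ → Bool) → ∀ n, Fin n → Bool := fun x n i => x i
  have hmono : ∀ x n k, (U (n + k)).1 (res x (n + k)) ⊆ (U n).1 (res x n) := by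
    intro x n k
    induction k with
    | zero => exact subset_rfl
    | succ k ih =>
      refine Subset.trans ?_ ih
      exact subset_closure.trans (hn1 (n + k) (U (n + k)) (res x (n + k + 1)))
  have hmem : ∀ x n m, n ≤ m → t m (res x m) ∈ (U n).1 (res x n) := by
    intro x n m hnm
    obtain ⟨k, rfl⟩ := Nat.exists_eq_add_of_le hnm
    exact hmono x n k ((ht (n + k)).2 _)
  have hcauchy : ∀ x, CauchySeq fun n => t (n + 1) (res x (n + 1)) := by
    intro x
    refine cauchySeq_of_le_tendsto_0 (fun n => (1 / 2 : ℝ) ^ n) (fun n m N hn hm => ?_)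
      (tendsto_pow_atTop_nhds_zero_of_lt_one (by norm_num) (by norm_num))
    exact hn2 N (U N) (res x (N + 1)) _ (hmem x (N + 1) (n + 1) (by omega)) _
      (hmem x (N + 1) (m + 1) (by omega))
  choose φ hφ using fun x => cauchySeq_tendsto_of_complete (hcauchy x)
  have hφU : ∀ x n, φ x ∈ (U n).1 (res x n) := by
    intro x n
    refine hn1 n (U n) (res x (n + 1)) (mem_closure_of_tendsto (hφ x) ?_)
    filter_upwards [Filter.eventually_ge_atTop n] with m hm
    exact hmem x (n + 1) (m + 1) (by omega)
  -- At each stage the approximating points form one tuple in a single fibre, so by continuity all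
  -- the limits share a fibre.
  have hφp : ∀ x y, p (φ x) = p (φ y) := by
    intro x y
    have h1 := (hp.tendsto _).comp (hφ x)
    have h2 := (hp.tendsto _).comp (hφ y)
    refine tendsto_nhds_unique h1 (h2.congr fun n => ?_)
    exact (ht (n + 1)).1 _ _
  have hφi : Function.Injective φ := by
    intro x y hxy
    by_contra hne
    have hex : ∃ n, x n ≠ y n := by
      by_contra hcon
      push Not at hcon
      exact hne (funext hcon)
    set n := Nat.find hex with hn
    have hd := hn3 n (U n) (res x (n + 1)) (res y (n + 1)) (fun i => by
      have := Nat.find_min hex i.2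
      push Not at this
      exact this) (Nat.find_spec hex)
    exact Set.disjoint_left.1 hd (hφU x (n + 1)) (hxy ▸ hφU y (n + 1))
  have hcount : (range φ).Countable := (hc (p (φ fun _ => false))).mono (by
    rintro _ ⟨x, rfl⟩
    exact hφp _ _)
  rw [← image_univ] at hcount
  have : Uncountable (ℕ → Bool) := by
    rw [← Cardinal.aleph0_lt_mk_iff]
    simpa using Cardinal.cantor Cardinal.aleph0
  exact not_countable_univ (countable_of_injective_of_countable_image hφi.injOn hcount)

end CantorScheme

/-- **Lusin–Novikov**: a measurable map with countable fibres between standard Borel spaces is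
injective on each of countably many measurable sets covering its domain. -/
theorem exists_cover_injOn {C X : Type*} [MeasurableSpace C] [StandardBorelSpace C]
    [MeasurableSpace X] [StandardBorelSpace X] {p : C → X} (hp : Measurable p)
    (hc : ∀ x, (p ⁻¹' {x}).Countable) :
    ∃ f : ℕ → Set C, (∀ n, MeasurableSet (f n)) ∧ (∀ n, InjOn p (f n)) ∧ ⋃ n, f n = univ := by
  let := upgradeStandardBorel X
  obtain ⟨τ, hb, hpol⟩ := StandardBorelSpace.polish (α := C)
  -- Refining the Polish topology makes `p` continuous without changing the Borel sets.
  obtain ⟨τ', hle, hcont, hpol'⟩ := @Measurable.exists_continuous C X τ hpol _ hb _ _ _ p _ hp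
  have hb' : @BorelSpace C τ' _ :=
    ⟨by rw [hb.measurable_eq]; exact (@borel_eq_borel_of_le C τ' τ hpol' hpol hle).symm⟩
  let := τ'
  let := TopologicalSpace.upgradeIsCompletelyMetrizable C
  obtain ⟨f, hf, hcov⟩ := sigmaInjOn_univ_of_continuous hcont hc
  exact ⟨f, fun n => (hf n).1, fun n => (hf n).2, univ_subset_iff.1 hcov⟩

/-! ### Borel sets with countable sections -/

section CountableSections

variable {A B : Type*} [MeasurableSpace A] [StandardBorelSpace A] [MeasurableSpace B]
  [StandardBorelSpace B] {P : Set (A × B)}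

/-- A Borel set with countable sections is a countable union of Borel partial functions. -/
theorem exists_cover_functional (hP : MeasurableSet P) (hc : ∀ a, {b | (a, b) ∈ P}.Countable) :
    ∃ f : ℕ → Set (A × B), (∀ n, MeasurableSet (f n)) ∧ (∀ n, f n ⊆ P) ∧
      (∀ n a b b', (a, b) ∈ f n → (a, b') ∈ f n → b = b') ∧ ∀ p ∈ P, ∃ n, p ∈ f n := by
  have := hP.standardBorel
  obtain ⟨g, hg, hgi, hgc⟩ := exists_cover_injOn (p := fun x : P => x.1.1)
    (measurable_fst.comp measurable_subtype_coe) (fun a => by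
      refine countable_of_injective_of_countable_image (f := fun x : P => x.1.2) ?_
        ((hc a).mono ?_)
      · rintro ⟨⟨a1, b1⟩, h1⟩ hx ⟨⟨a2, b2⟩, h2⟩ hy h
        simp_all
      · rintro _ ⟨⟨⟨a1, b1⟩, h1⟩, hx, rfl⟩
        simp only [mem_preimage, mem_singleton_iff] at hx
        subst hx
        exact h1)
  refine ⟨fun n => Subtype.val '' g n, fun n => hP.subtype_image (hg n), ?_, ?_, ?_⟩
  · rintro n _ ⟨x, _, rfl⟩
    exact x.2
  · rintro n a b b' ⟨x, hx, hxe⟩ ⟨y, hy, hye⟩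
    have := hgi n hx hy (by simp [hxe, hye])
    subst this
    simpa using hxe.symm.trans hye
  · intro p hp
    have : (⟨p, hp⟩ : P) ∈ ⋃ n, g n := hgc ▸ mem_univ _
    obtain ⟨n, hn⟩ := mem_iUnion.1 this
    exact ⟨n, ⟨p, hp⟩, hn, rfl⟩

/-- The projection of a Borel set with countable sections is Borel. -/
theorem measurableSet_exists_of_countable (hP : MeasurableSet P)
    (hc : ∀ a, {b | (a, b) ∈ P}.Countable) : MeasurableSet {a | ∃ b, (a, b) ∈ P} := by
  obtain ⟨f, hf, hfP, hfu, hfc⟩ := exists_cover_functional hP hc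
  have : {a | ∃ b, (a, b) ∈ P} = ⋃ n, Prod.fst '' f n := by
    ext a
    simp only [mem_ofPred_eq, mem_iUnion, mem_image, Prod.exists, exists_and_right, exists_eq_right]
    constructor
    · rintro ⟨b, hb⟩
      obtain ⟨n, hn⟩ := hfc _ hb
      exact ⟨n, b, hn⟩
    · rintro ⟨n, b, hb⟩
      exact ⟨b, hfP n hb⟩
  rw [this]
  refine MeasurableSet.iUnion fun n => (hf n).image_of_measurable_injOn measurable_fst ?_
  rintro ⟨a, b⟩ h1 ⟨a', b'⟩ h2 h
  simp only at h
  subst h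
  rw [hfu n a b b' h1 h2]

/-- The projection of a Borel partial function is Borel. -/
theorem measurableSet_exists_of_unique (hP : MeasurableSet P)
    (hc : ∀ a b b', (a, b) ∈ P → (a, b') ∈ P → b = b') : MeasurableSet {a | ∃ b, (a, b) ∈ P} :=
  measurableSet_exists_of_countable hP fun a =>
    Set.Subsingleton.countable fun _ hb _ hb' => hc a _ _ hb hb'

/-- A Borel set with countable sections has a Borel uniformization. -/
theorem exists_uniformization (hP : MeasurableSet P) (hc : ∀ a, {b | (a, b) ∈ P}.Countable) :
    ∃ U, MeasurableSet U ∧ U ⊆ P ∧ (∀ a b b', (a, b) ∈ U → (a, b') ∈ U → b = b') ∧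
      ∀ a b, (a, b) ∈ P → ∃ b', (a, b') ∈ U := by
  obtain ⟨f, hf, hfP, hfu, hfc⟩ := exists_cover_functional hP hc
  have hd : ∀ n, MeasurableSet {a | ∃ b, (a, b) ∈ f n} := fun n =>
    measurableSet_exists_of_unique (hf n) (hfu n)
  refine ⟨⋃ n, f n ∩ {p | ∀ k < n, ¬ ∃ b, (p.1, b) ∈ f k}, ?_, ?_, ?_, ?_⟩
  · refine MeasurableSet.iUnion fun n => (hf n).inter ?_
    simp only [ofPred_forall]
    exact MeasurableSet.iInter fun k => MeasurableSet.iInter fun _ => (measurable_fst (hd k)).compl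
  · exact iUnion_subset fun n => inter_subset_left.trans (hfP n)
  · intro a b b' h h'
    obtain ⟨n, hn, hn'⟩ := mem_iUnion.1 h
    obtain ⟨m, hm, hm'⟩ := mem_iUnion.1 h'
    have : n = m := by
      by_contra hne
      rcases lt_or_gt_of_ne hne with hlt | hlt
      · exact hm' n hlt ⟨b, hn⟩
      · exact hn' m hlt ⟨b', hm⟩
    subst this
    exact hfu n a b b' hn hm
  · classical
    intro a b hab
    have hex : ∃ n, ∃ b', (a, b') ∈ f n := by
      obtain ⟨n, hn⟩ := hfc _ hab
      exact ⟨n, b, hn⟩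
    obtain ⟨b', hb'⟩ := Nat.find_spec hex
    exact ⟨b', mem_iUnion.2 ⟨Nat.find hex, hb', fun k hk => Nat.find_min hex hk⟩⟩

end CountableSections

/-! ### Borel matchings between spaces fibred over a common set -/

/-- `q : Z → Q` and `r : W → Q` have countable fibres and Borel fibre product. -/
structure BorelOver {Z W Q : Type*} [MeasurableSpace Z] [MeasurableSpace W] (q : Z → Q)
    (r : W → Q) : Prop where
  borel : MeasurableSet {p : Z × W | q p.1 = r p.2}
  countable_left : ∀ c, (q ⁻¹' {c}).Countable
  countable_right : ∀ c, (r ⁻¹' {c}).Countable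

/-- A Borel partial bijection between `Z` and `W` over `Q`. -/
structure IsMatching {Z W Q : Type*} [MeasurableSpace Z] [MeasurableSpace W] (q : Z → Q)
    (r : W → Q) (M : Set (Z × W)) : Prop where
  measurableSet : MeasurableSet M
  fibre_eq : ∀ {z w}, (z, w) ∈ M → q z = r w
  right_unique : ∀ {z w w'}, (z, w) ∈ M → (z, w') ∈ M → w = w'
  left_unique : ∀ {z z' w}, (z, w) ∈ M → (z', w) ∈ M → z = z'

/-- Every point over `c` lies in the domain of `M`. -/
def LeftTotal {Z W Q : Type*} (q : Z → Q) (M : Set (Z × W)) (c : Q) : Prop :=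
  ∀ z, q z = c → ∃ w, (z, w) ∈ M

/-- Every point over `c` lies in the range of `M`. -/
def RightTotal {Z W Q : Type*} (r : W → Q) (M : Set (Z × W)) (c : Q) : Prop :=
  ∀ w, r w = c → ∃ z, (z, w) ∈ M

section MatchingBasic

variable {Z W Q : Type*} [MeasurableSpace Z] [MeasurableSpace W] {q : Z → Q} {r : W → Q}

theorem BorelOver.symm (h : BorelOver q r) : BorelOver r q where
  borel := by
    have : {p : W × Z | r p.1 = q p.2} = Prod.swap ⁻¹' {p : Z × W | q p.1 = r p.2} := by
      ext p
      exact eq_comm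
    rw [this]
    exact measurable_swap h.borel
  countable_left := h.countable_right
  countable_right := h.countable_left

theorem IsMatching.symm {M : Set (Z × W)} (h : IsMatching q r M) :
    IsMatching r q (Prod.swap ⁻¹' M) where
  measurableSet := measurable_swap h.measurableSet
  fibre_eq hm := (h.fibre_eq hm).symm
  right_unique h1 h2 := h.left_unique h1 h2
  left_unique h1 h2 := h.right_unique h1 h2

/-- Countably many matchings can be glued along sets of points of `Q` with Borel preimage. -/
theorem exists_glued_matching {M : ℕ → Set (Z × W)} (hM : ∀ i, IsMatching q r (M i))
    {S : ℕ → Set Q} (hS : ∀ i, MeasurableSet (q ⁻¹' S i)) :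
    ∃ N, IsMatching q r N ∧ ∀ c, (∃ i, c ∈ S i) →
      ∃ i, c ∈ S i ∧ ∀ z w, q z = c → ((z, w) ∈ N ↔ (z, w) ∈ M i) := by
  -- Over `c` use the first index whose set contains `c`. Matchings preserve the base point, so
  -- pieces over different `F i` cannot collide.
  let F : ℕ → Set Q := fun i => {c | c ∈ S i ∧ ∀ j < i, c ∉ S j}
  have hF : ∀ i, MeasurableSet (q ⁻¹' F i) := by
    intro i
    have : q ⁻¹' F i = q ⁻¹' S i ∩ ⋂ j, ⋂ (_ : j < i), (q ⁻¹' S j)ᶜ := by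
      ext z
      simp [F]
    rw [this]
    exact (hS i).inter (MeasurableSet.iInter fun j => MeasurableSet.iInter fun _ => (hS j).compl)
  have hFu : ∀ {c i j}, c ∈ F i → c ∈ F j → i = j := by
    intro c i j hi hj
    by_contra hne
    rcases lt_or_gt_of_ne hne with hlt | hlt
    exacts [hj.2 i hlt hi.1, hi.2 j hlt hj.1]
  refine ⟨⋃ i, M i ∩ Prod.fst ⁻¹' (q ⁻¹' F i), ⟨?_, ?_, ?_, ?_⟩, ?_⟩
  · exact MeasurableSet.iUnion fun i => (hM i).measurableSet.inter (measurable_fst (hF i))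
  · intro z w h
    obtain ⟨i, hi⟩ := mem_iUnion.1 h
    exact (hM i).fibre_eq hi.1
  · intro z w w' h h'
    obtain ⟨i, hi⟩ := mem_iUnion.1 h
    obtain ⟨j, hj⟩ := mem_iUnion.1 h'
    obtain rfl := hFu hi.2 hj.2
    exact (hM i).right_unique hi.1 hj.1
  · intro z z' w h h'
    obtain ⟨i, hi⟩ := mem_iUnion.1 h
    obtain ⟨j, hj⟩ := mem_iUnion.1 h'
    have hzz : q z = q z' := ((hM i).fibre_eq hi.1).trans ((hM j).fibre_eq hj.1).symm
    have hj2 : q z' ∈ F j := hj.2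
    obtain rfl := hFu hi.2 (hzz ▸ hj2)
    exact (hM i).left_unique hi.1 hj.1
  · classical
    intro c hc
    have hcF : c ∈ F (Nat.find hc) := ⟨Nat.find_spec hc, fun j hj => Nat.find_min hc hj⟩
    refine ⟨Nat.find hc, Nat.find_spec hc, fun z w hz => ⟨fun h => ?_, fun h => ?_⟩⟩
    · obtain ⟨j, hj⟩ := mem_iUnion.1 h
      have hj2 : q z ∈ F j := hj.2
      rw [hz] at hj2
      rw [hFu hcF hj2]
      exact hj.1
    · refine mem_iUnion.2 ⟨_, h, ?_⟩
      show q z ∈ F _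
      rwa [hz]

end MatchingBasic

/-! ### Comparison and Schröder–Bernstein over a base -/

section Matching

variable {Z W Q : Type*} [MeasurableSpace Z] [StandardBorelSpace Z] [MeasurableSpace W]
  [StandardBorelSpace W] {q : Z → Q} {r : W → Q}

theorem IsMatching.measurableSet_dom {M : Set (Z × W)} (h : IsMatching q r M) :
    MeasurableSet {z | ∃ w, (z, w) ∈ M} :=
  measurableSet_exists_of_unique h.measurableSet fun _ _ _ => h.right_unique

theorem IsMatching.measurableSet_ran {M : Set (Z × W)} (h : IsMatching q r M) :
    MeasurableSet {w | ∃ z, (z, w) ∈ M} :=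
  h.symm.measurableSet_dom

/-- The saturation of a Borel set is Borel. -/
theorem BorelOver.measurableSet_saturation (h : BorelOver q r) {S : Set W}
    (hS : MeasurableSet S) : MeasurableSet {z | ∃ w, q z = r w ∧ w ∈ S} :=
  measurableSet_exists_of_countable (P := {p : Z × W | q p.1 = r p.2 ∧ p.2 ∈ S})
    (h.borel.inter (measurable_snd hS)) fun z => (h.countable_right (q z)).mono
      fun _ hw => hw.1.symm

theorem IsMatching.measurableSet_leftTotal {M : Set (Z × W)} (hM : IsMatching q r M)
    {Y : Type*} [MeasurableSpace Y] [StandardBorelSpace Y] {s : Y → Q} (h : BorelOver s q) :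
    MeasurableSet (s ⁻¹' {c | LeftTotal q M c}) := by
  have := (h.measurableSet_saturation hM.measurableSet_dom.compl).compl
  convert this using 1
  ext y
  simp only [mem_preimage, mem_ofPred_eq, LeftTotal, mem_compl_iff, not_exists, not_and]
  exact forall_congr' fun z => ⟨fun h1 h2 => by simpa using h1 h2.symm,
    fun h1 h2 => by simpa using h1 h2.symm⟩

theorem IsMatching.measurableSet_rightTotal {M : Set (Z × W)} (hM : IsMatching q r M)
    {Y : Type*} [MeasurableSpace Y] [StandardBorelSpace Y] {s : Y → Q} (h : BorelOver s r) :
    MeasurableSet (s ⁻¹' {c | RightTotal r M c}) :=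
  hM.symm.measurableSet_leftTotal h

/-- The fibre product is a disjoint countable union of matchings. -/
theorem BorelOver.exists_matching_cover (h : BorelOver q r) :
    ∃ R : ℕ → Set (Z × W), (∀ n, IsMatching q r (R n)) ∧ ∀ z w, q z = r w → ∃! n, (z, w) ∈ R n := by
  obtain ⟨f, hf, hfP, hfu, hfc⟩ := exists_cover_functional h.borel
    fun z => (h.countable_right (q z)).mono fun _ hw => hw.symm
  obtain ⟨g, hg, hgP, hgu, hgc⟩ := exists_cover_functional h.symm.borel
    fun z => (h.countable_left (r z)).mono fun _ hw => hw.symm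
  -- Intersecting a graph functional from `Z` to `W` with one functional from `W` to `Z` gives a
  -- partial bijection; disjointing makes the index unique.
  let T : ℕ → Set (Z × W) := fun n => f n.unpair.1 ∩ Prod.swap ⁻¹' g n.unpair.2
  have hsub : ∀ n, disjointed T n ⊆ T n := disjointed_subset T
  have hT : ∀ n, MeasurableSet (T n) := fun n => (hf _).inter (measurable_swap (hg _))
  refine ⟨disjointed T, fun n => ⟨MeasurableSet.disjointed hT n, fun hm => hfP _ (hsub n hm).1,
    fun h1 h2 => hfu _ _ _ _ (hsub n h1).1 (hsub n h2).1,
    fun h1 h2 => hgu _ _ _ _ (hsub n h1).2 (hsub n h2).2⟩, fun z w hzw => ?_⟩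
  obtain ⟨n, hn⟩ := hfc (z, w) hzw
  obtain ⟨m, hm⟩ := hgc (w, z) hzw.symm
  have hmem : (z, w) ∈ ⋃ k, disjointed T k := by
    rw [iUnion_disjointed]
    exact mem_iUnion.2 ⟨Nat.pair n m, by simpa [T] using ⟨hn, hm⟩⟩
  obtain ⟨k, hk⟩ := mem_iUnion.1 hmem
  refine ⟨k, hk, fun l hl => ?_⟩
  by_contra hne
  exact Set.disjoint_left.1 (disjoint_disjointed T hne) hl hk

/-- **Comparison**: there is a matching which over every point of `Q` is total on one of the two
sides. -/
theorem BorelOver.exists_maximal_matching (h : BorelOver q r) :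
    ∃ M, IsMatching q r M ∧ ∀ z w, q z = r w → (∃ w', (z, w') ∈ M) ∨ ∃ z', (z', w) ∈ M := by
  obtain ⟨R, hR, hRc⟩ := h.exists_matching_cover
  -- Greedy construction: at stage `n` add the pairs of `R n` with both ends still free.
  let M : ℕ → Set (Z × W) := fun n => Nat.rec ∅ (fun n M => M ∪
    (R n ∩ {p | (¬ ∃ w, (p.1, w) ∈ M) ∧ ¬ ∃ z, (z, p.2) ∈ M})) n
  have hMs : ∀ n, M (n + 1) = M n ∪
    (R n ∩ {p | (¬ ∃ w, (p.1, w) ∈ M n) ∧ ¬ ∃ z, (z, p.2) ∈ M n}) := fun n => rfl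
  have hM : ∀ n, IsMatching q r (M n) := by
    intro n
    induction n with
    | zero => exact ⟨MeasurableSet.empty, fun h => h.elim, fun h => h.elim, fun h => h.elim⟩
    | succ n ih =>
      rw [hMs]
      refine ⟨?_, ?_, ?_, ?_⟩
      · exact ih.measurableSet.union ((hR n).measurableSet.inter
          ((measurable_fst ih.measurableSet_dom).compl.inter
            (measurable_snd ih.measurableSet_ran).compl))
      · rintro z w (h | h)
        exacts [ih.fibre_eq h, (hR n).fibre_eq h.1]
      · rintro z w w' (h | h) (h' | h')
        · exact ih.right_unique h h'
        · exact (h'.2.1 ⟨_, h⟩).elim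
        · exact (h.2.1 ⟨_, h'⟩).elim
        · exact (hR n).right_unique h.1 h'.1
      · rintro z w w' (h | h) (h' | h')
        · exact ih.left_unique h h'
        · exact (h'.2.2 ⟨_, h⟩).elim
        · exact (h.2.2 ⟨_, h'⟩).elim
        · exact (hR n).left_unique h.1 h'.1
  have hmono : Monotone M := monotone_nat_of_le_succ fun n => by
    rw [hMs]
    exact subset_union_left
  have hpair : ∀ {p p'}, p ∈ ⋃ n, M n → p' ∈ ⋃ n, M n → ∃ n, p ∈ M n ∧ p' ∈ M n := by
    intro p p' hp hp'
    obtain ⟨n, hn⟩ := mem_iUnion.1 hp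
    obtain ⟨m, hm⟩ := mem_iUnion.1 hp'
    exact ⟨max n m, hmono (le_max_left _ _) hn, hmono (le_max_right _ _) hm⟩
  refine ⟨⋃ n, M n, ⟨MeasurableSet.iUnion fun n => (hM n).measurableSet, ?_, ?_, ?_⟩, ?_⟩
  · intro z w hzw
    obtain ⟨n, hn⟩ := mem_iUnion.1 hzw
    exact (hM n).fibre_eq hn
  · intro z w w' h1 h2
    obtain ⟨n, hn, hn'⟩ := hpair h1 h2
    exact (hM n).right_unique hn hn'
  · intro z w w' h1 h2
    obtain ⟨n, hn, hn'⟩ := hpair h1 h2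
    exact (hM n).left_unique hn hn'
  · intro z w hzw
    by_contra hcon
    push Not at hcon
    obtain ⟨n, hn, -⟩ := hRc z w hzw
    refine hcon.1 w (mem_iUnion.2 ⟨n + 1, ?_⟩)
    rw [hMs]
    refine Or.inr ⟨hn, ?_, ?_⟩
    · rintro ⟨w', hw'⟩
      exact hcon.1 w' (mem_iUnion.2 ⟨n, hw'⟩)
    · rintro ⟨z', hz'⟩
      exact hcon.2 z' (mem_iUnion.2 ⟨n, hz'⟩)

/-- **Schröder–Bernstein** for matchings. -/
theorem IsMatching.schroederBernstein {M₁ M₂ : Set (Z × W)} (h₁ : IsMatching q r M₁)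
    (h₂ : IsMatching q r M₂) : ∃ M, IsMatching q r M ∧ ∀ c, LeftTotal q M₁ c →
      RightTotal r M₂ c → LeftTotal q M c ∧ RightTotal r M c := by
  -- The union of the `D n` is the set of points reached from outside the domain of `M₂` by
  -- repeatedly following `M₁` and then `M₂` backwards. The result uses `M₁` on this union and `M₂`
  -- off it.
  let D : ℕ → Set Z := fun n => Nat.rec {z | ¬ ∃ w, (z, w) ∈ M₂}
    (fun _ D => {z | ∃ w, (z, w) ∈ M₂ ∧ ∃ z', (z', w) ∈ M₁ ∧ z' ∈ D}) n
  have hDs : ∀ n, D (n + 1) = {z | ∃ w, (z, w) ∈ M₂ ∧ ∃ z', (z', w) ∈ M₁ ∧ z' ∈ D n} :=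
    fun n => rfl
  have hD : ∀ n, MeasurableSet (D n) := by
    intro n
    induction n with
    | zero => exact h₂.measurableSet_dom.compl
    | succ n ih =>
      rw [hDs]
      refine measurableSet_exists_of_unique
        (P := {p : Z × W | p ∈ M₂ ∧ ∃ z', (z', p.2) ∈ M₁ ∧ z' ∈ D n}) ?_
        fun z w w' h h' => h₂.right_unique h.1 h'.1
      have hE : MeasurableSet {w | ∃ z', (z', w) ∈ M₁ ∧ z' ∈ D n} :=
        measurableSet_exists_of_unique (P := {p : W × Z | (p.2, p.1) ∈ M₁ ∧ p.2 ∈ D n})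
          ((measurable_swap h₁.measurableSet).inter (measurable_snd ih))
          fun w z z' h h' => h₁.left_unique h.1 h'.1
      exact h₂.measurableSet.inter (measurable_snd hE)
  have hDu : MeasurableSet (⋃ n, D n) := MeasurableSet.iUnion hD
  have key : ∀ {z z' w}, (z, w) ∈ M₁ → z ∈ ⋃ n, D n → (z', w) ∈ M₂ → z' ∈ ⋃ n, D n := by
    intro z z' w h1 hz h2
    obtain ⟨n, hn⟩ := mem_iUnion.1 hz
    exact mem_iUnion.2 ⟨n + 1, w, h2, z, h1, hn⟩
  refine ⟨M₁ ∩ Prod.fst ⁻¹' (⋃ n, D n) ∪ M₂ ∩ Prod.fst ⁻¹' (⋃ n, D n)ᶜ, ⟨?_, ?_, ?_, ?_⟩, ?_⟩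
  · exact (h₁.measurableSet.inter (measurable_fst hDu)).union
      (h₂.measurableSet.inter (measurable_fst hDu.compl))
  · rintro z w (h | h)
    exacts [h₁.fibre_eq h.1, h₂.fibre_eq h.1]
  · rintro z w w' (h | h) (h' | h')
    · exact h₁.right_unique h.1 h'.1
    · exact (h'.2 h.2).elim
    · exact (h.2 h'.2).elim
    · exact h₂.right_unique h.1 h'.1
  · rintro z z' w (h | h) (h' | h')
    · exact h₁.left_unique h.1 h'.1
    · exact (h'.2 (key h.1 h.2 h'.1)).elim
    · exact (h.2 (key h'.1 h'.2 h.1)).elim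
    · exact h₂.left_unique h.1 h'.1
  · refine fun c hl hr => ⟨fun z hz => ?_, fun w hw => ?_⟩
    · by_cases hzD : z ∈ ⋃ n, D n
      · obtain ⟨w, hw⟩ := hl z hz
        exact ⟨w, Or.inl ⟨hw, hzD⟩⟩
      · have : ∃ w, (z, w) ∈ M₂ := by
          by_contra hcon
          exact hzD (mem_iUnion.2 ⟨0, hcon⟩)
        obtain ⟨w, hw⟩ := this
        exact ⟨w, Or.inr ⟨hw, hzD⟩⟩
    · obtain ⟨z, hz⟩ := hr w hw
      by_cases hzD : z ∈ ⋃ n, D n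
      · obtain ⟨n, hn⟩ := mem_iUnion.1 hzD
        cases n with
        | zero => exact (hn ⟨w, hz⟩).elim
        | succ n =>
          obtain ⟨w', hw', z', hz', hz'D⟩ := hn
          obtain rfl := h₂.right_unique hz hw'
          exact ⟨z', Or.inl ⟨hz', mem_iUnion.2 ⟨n, hz'D⟩⟩⟩
      · exact ⟨z, Or.inr ⟨hz, hzD⟩⟩

end Matching

/-! ### Absorption and cancellation -/

/-- Pairs `(a, b)` such that `b` is the `m`-th iterate under `τ` of a point `a` outside the range
of `τ`. -/
def iterateOfNotRange {X : Type*} (τ : Set (X × X)) (m : ℕ) : Set (X × X) :=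
  Nat.rec {p | p.1 = p.2 ∧ ¬ ∃ a, (a, p.1) ∈ τ}
    (fun _ P => {p | ∃ b, (p.1, b) ∈ P ∧ (b, p.2) ∈ τ}) m

/-- Backward orbits of an injective `τ` are unique, and stop exactly on leaving the range; the end
point therefore remembers both the start and the number of steps. -/
theorem iterateOfNotRange_injective {X Q : Type*} [MeasurableSpace X] {x : X → Q}
    {τ : Set (X × X)} (hτ : IsMatching x x τ) {m m' : ℕ}
    {a a' b : X} (h : (a, b) ∈ iterateOfNotRange τ m) (h' : (a', b) ∈ iterateOfNotRange τ m') :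
    a = a' ∧ m = m' := by
  induction m generalizing m' b with
  | zero =>
    cases m' with
    | zero => exact ⟨h.1.trans h'.1.symm, rfl⟩
    | succ m' =>
      obtain ⟨c, -, hc⟩ := h'
      exact (h.2 ⟨c, by rw [h.1]; exact hc⟩).elim
  | succ m ih =>
    obtain ⟨c, hc, hc'⟩ := h
    cases m' with
    | zero => exact (h'.2 ⟨c, by rw [h'.1]; exact hc'⟩).elim
    | succ m' =>
      obtain ⟨d, hd, hd'⟩ := h'
      obtain rfl := hτ.left_unique hc' hd'
      obtain ⟨rfl, rfl⟩ := ih hc hd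
      exact ⟨rfl, rfl⟩

section Absorption

variable {V W L X Q : Type*} [MeasurableSpace V] [StandardBorelSpace V] [MeasurableSpace W]
  [StandardBorelSpace W] [MeasurableSpace L] [StandardBorelSpace L] [MeasurableSpace X]
  [StandardBorelSpace X] {v : V → Q} {w : W → Q} {l : L → Q} {x : X → Q}

/-- If `H` embeds infinitely many copies of `ℓ` into `W` over `Q`, then every `V` with countable
fibres embeds into `W` over the points of `Q` lying below such an `ℓ`. -/
theorem exists_matching_of_infinite (hVL : BorelOver v l) {H : Set ((L × ℕ) × W)}
    (hH : IsMatching (fun t : L × ℕ => l t.1) w H) :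
    ∃ M, IsMatching v w M ∧
      ∀ ℓ, {m | ∃ y, ((ℓ, m), y) ∈ H}.Infinite → LeftTotal v M (l ℓ) := by
  classical
  let D : L → ℕ → Prop := fun ℓ m => ∃ y, ((ℓ, m), y) ∈ H
  have hD : ∀ m, MeasurableSet {ℓ | D ℓ m} := fun m =>
    (measurable_id.prodMk measurable_const : Measurable fun ℓ : L => (ℓ, m)) hH.measurableSet_dom
  have hcnt : ∀ m, Measurable fun ℓ => Nat.count (D ℓ) m := by
    intro m
    induction m with
    | zero => simp
    | succ m ih =>
      simp only [Nat.count_succ]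
      exact ih.add (Measurable.ite (hD m) measurable_const measurable_const)
  have hinf : MeasurableSet {ℓ | {m | D ℓ m}.Infinite} := by
    have : {ℓ | {m | D ℓ m}.Infinite} = ⋂ n, ⋃ m, ⋃ (_ : n < m), {ℓ | D ℓ m} := by
      ext ℓ
      simp [Set.infinite_iff_exists_gt, and_comm]
    rw [this]
    exact MeasurableSet.iInter fun n => MeasurableSet.iUnion fun m =>
      MeasurableSet.iUnion fun _ => hD m
  obtain ⟨U, hU, hUP, hUu, hUt⟩ := exists_uniformization
    (P := {p : V × L | v p.1 = l p.2 ∧ {m | D p.2 m}.Infinite})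
    (hVL.borel.inter (measurable_snd hinf))
    (fun z => (hVL.countable_right (v z)).mono fun _ h => h.1.symm)
  obtain ⟨R, hR, hRc⟩ := hVL.exists_matching_cover
  -- Route from `a` to `b`: `U` chooses an `ℓ`, the index `i` with `(a, ℓ) ∈ R i` encodes `a` among
  -- the points over `ℓ`, and `b` is the copy of `ℓ` numbered by the `i`-th usable `m` (counting
  -- from zero). The condition on `Nat.count` expresses the last requirement.
  let K : Set ((V × W) × (L × ℕ × ℕ)) := {p | (p.1.1, p.2.1) ∈ U ∧ (p.1.1, p.2.1) ∈ R p.2.2.1 ∧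
    ((p.2.1, p.2.2.2), p.1.2) ∈ H ∧ Nat.count (D p.2.1) p.2.2.2 = p.2.2.1}
  have hK : MeasurableSet K := by
    have : K = ⋃ i, ⋃ m, {p : (V × W) × (L × ℕ × ℕ) | p.2.2 = (i, m)} ∩
        ({p | (p.1.1, p.2.1) ∈ U} ∩ ({p | (p.1.1, p.2.1) ∈ R i} ∩
        ({p | ((p.2.1, m), p.1.2) ∈ H} ∩ {p | Nat.count (D p.2.1) m = i}))) := by
      ext ⟨⟨a, b⟩, ℓ, i, m⟩
      simp [K]
    rw [this]
    refine MeasurableSet.iUnion fun i => MeasurableSet.iUnion fun m => ?_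
    refine MeasurableSet.inter ?_ (MeasurableSet.inter ?_ (MeasurableSet.inter ?_
      (MeasurableSet.inter ?_ ?_)))
    · exact (measurable_snd.comp measurable_snd) (measurableSet_singleton (i, m))
    · exact (by fun_prop : Measurable fun p : (V × W) × (L × ℕ × ℕ) => (p.1.1, p.2.1)) hU
    · exact (by fun_prop : Measurable fun p : (V × W) × (L × ℕ × ℕ) => (p.1.1, p.2.1))
        (hR i).measurableSet
    · exact (by fun_prop : Measurable fun p : (V × W) × (L × ℕ × ℕ) => ((p.2.1, m), p.1.2))
        hH.measurableSet
    · exact ((hcnt m).comp (by fun_prop :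
        Measurable fun p : (V × W) × (L × ℕ × ℕ) => p.2.1)) (measurableSet_singleton i)
  have hKu : ∀ {a b b' t t'}, ((a, b), t) ∈ K → ((a, b'), t') ∈ K → t = t' := by
    rintro a b b' ⟨ℓ, i, m⟩ ⟨ℓ', i', m'⟩ ⟨h1, h2, h3, h4⟩ ⟨h1', h2', h3', h4'⟩
    obtain rfl : ℓ = ℓ' := hUu _ _ _ h1 h1'
    obtain rfl : i = i' := (hRc a ℓ ((hR i).fibre_eq h2)).unique h2 h2'
    obtain rfl : m = m' := Nat.count_injective (p := D ℓ) ⟨_, h3⟩ ⟨_, h3'⟩ (h4.trans h4'.symm)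
    rfl
  refine ⟨{p | ∃ t, (p, t) ∈ K}, ⟨?_, ?_, ?_, ?_⟩, ?_⟩
  · exact measurableSet_exists_of_unique hK fun _ _ _ h h' => hKu h h'
  · rintro a b ⟨⟨ℓ, i, m⟩, h1, h2, h3, h4⟩
    exact ((hR i).fibre_eq h2).trans (hH.fibre_eq h3)
  · rintro a b b' ⟨t, ht⟩ ⟨t', ht'⟩
    obtain rfl := hKu ht ht'
    exact hH.right_unique ht.2.2.1 ht'.2.2.1
  · rintro a a' b ⟨⟨ℓ, i, m⟩, h1, h2, h3, h4⟩ ⟨⟨ℓ', i', m'⟩, h1', h2', h3', h4'⟩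
    have h := hH.left_unique h3 h3'
    simp only [Prod.mk.injEq] at h
    obtain ⟨rfl, rfl⟩ := h
    have hii : i = i' := h4.symm.trans h4'
    subst hii
    exact (hR i).left_unique h2 h2'
  · intro ℓ₀ hℓ₀ a ha
    obtain ⟨ℓ, hℓ⟩ := hUt a ℓ₀ ⟨ha, hℓ₀⟩
    obtain ⟨i, hi, -⟩ := hRc a ℓ (hUP hℓ).1
    have hInf : (Set.ofPred (D ℓ)).Infinite := (hUP hℓ).2
    obtain ⟨b, hb⟩ : D ℓ (Nat.nth (D ℓ) i) := Nat.nth_mem_of_infinite hInf i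
    exact ⟨b, (ℓ, i, _), hℓ, hi, hb, Nat.count_nth_of_infinite hInf i⟩

theorem isMatching_iterateOfNotRange {τ : Set (X × X)} (hτ : IsMatching x x τ) (m : ℕ) :
    IsMatching x x (iterateOfNotRange τ m) := by
  refine ⟨?_, ?_, ?_, fun h h' => (iterateOfNotRange_injective hτ h h').1⟩
  · induction m with
    | zero =>
      exact (measurableSet_eq_fun measurable_fst measurable_snd).inter
        (measurable_fst hτ.measurableSet_ran).compl
    | succ m ih =>
      exact measurableSet_exists_of_unique (P := {p : (X × X) × X |
        (p.1.1, p.2) ∈ iterateOfNotRange τ m ∧ (p.2, p.1.2) ∈ τ})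
        (((by fun_prop : Measurable fun p : (X × X) × X => (p.1.1, p.2)) ih).inter
          ((by fun_prop : Measurable fun p : (X × X) × X => (p.2, p.1.2)) hτ.measurableSet))
        fun _ _ _ h h' => hτ.left_unique h.2 h'.2
  · induction m with
    | zero =>
      intro a b h
      exact congrArg x h.1
    | succ m ih =>
      rintro a b ⟨c, hc, hc'⟩
      exact (ih hc).trans (hτ.fibre_eq hc')
  · induction m with
    | zero =>
      intro a b b' h h'
      exact h.1.symm.trans h'.1
    | succ m ih =>
      rintro a b b' ⟨c, hc, hc'⟩ ⟨d, hd, hd'⟩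
      obtain rfl := ih hc hd
      exact hτ.right_unique hc' hd'

/-- **Absorption**: if `τ` maps the points of `X` over `c` injectively and not surjectively to
themselves and `π : X → W` is finite-to-one over `Q`, then every `V` with countable fibres embeds
into `W` over `c`. -/
theorem exists_absorbing_matching (hVX : BorelOver v x) (hVV : BorelOver v v) {τ : Set (X × X)}
    (hτ : IsMatching x x τ) {π : X → W} (hπ : Measurable π) (hπx : ∀ a, w (π a) = x a)
    {n : ℕ} {idx : X → ℕ} (hidx : Measurable idx) (hlt : ∀ a, idx a < n)
    (hinj : ∀ a b, π a = π b → idx a = idx b → a = b) :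
    ∃ M, IsMatching v w M ∧ ∀ c, LeftTotal x τ c → ¬ RightTotal x τ c → LeftTotal v M c := by
  -- Send `(a, m)` to `π` of the `m`-th iterate of `a`, keeping only iterates of index `i`, since
  -- `π` is injective on points of equal index.
  let H : ℕ → Set ((X × ℕ) × W) := fun i =>
    {p | ∃ b, (p.1.1, b) ∈ iterateOfNotRange τ p.1.2 ∧ idx b = i ∧ π b = p.2}
  have hP := isMatching_iterateOfNotRange hτ
  have hH : ∀ i, IsMatching (fun t : X × ℕ => x t.1) w (H i) := by
    intro i
    refine ⟨?_, ?_, ?_, ?_⟩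
    · refine measurableSet_exists_of_unique (P := {p : ((X × ℕ) × W) × X |
        (p.1.1.1, p.2) ∈ iterateOfNotRange τ p.1.1.2 ∧ idx p.2 = i ∧ π p.2 = p.1.2}) ?_
        fun _ _ _ h h' => (hP _).right_unique h.1 h'.1
      have hm : MeasurableSet {p : ((X × ℕ) × W) × X |
          (p.1.1.1, p.2) ∈ iterateOfNotRange τ p.1.1.2} := by
        have : {p : ((X × ℕ) × W) × X | (p.1.1.1, p.2) ∈ iterateOfNotRange τ p.1.1.2} =
            ⋃ m, {p | p.1.1.2 = m} ∩ {p | (p.1.1.1, p.2) ∈ iterateOfNotRange τ m} := by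
          ext p
          simp
        rw [this]
        refine MeasurableSet.iUnion fun m => MeasurableSet.inter ?_ ?_
        · exact (by fun_prop : Measurable fun p : ((X × ℕ) × W) × X => p.1.1.2)
            (measurableSet_singleton m)
        · exact (by fun_prop : Measurable fun p : ((X × ℕ) × W) × X => (p.1.1.1, p.2))
            (hP m).measurableSet
      exact hm.inter (((hidx.comp measurable_snd) (measurableSet_singleton i)).inter
        (measurableSet_eq_fun (hπ.comp measurable_snd) (measurable_snd.comp measurable_fst)))
    · rintro ⟨a, m⟩ y ⟨b, hb, -, rfl⟩
      exact ((hP m).fibre_eq hb).trans (hπx b).symm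
    · rintro ⟨a, m⟩ y y' ⟨b, hb, -, rfl⟩ ⟨b', hb', -, rfl⟩
      rw [(hP m).right_unique hb hb']
    · rintro ⟨a, m⟩ ⟨a', m'⟩ y ⟨b, hb, hbi, rfl⟩ ⟨b', hb', hbi', hbb⟩
      obtain rfl := hinj _ _ hbb (hbi'.trans hbi.symm)
      obtain ⟨h1, h2⟩ := iterateOfNotRange_injective hτ hb hb'
      exact Prod.ext h1 h2
  choose M hM hMt using fun i => exists_matching_of_infinite hVX (hH i)
  obtain ⟨N, hN, hNt⟩ := exists_glued_matching hM (S := fun i => {c | LeftTotal v (M i) c})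
    fun i => (hM i).measurableSet_leftTotal hVV
  refine ⟨N, hN, fun c hl hr => ?_⟩
  simp only [RightTotal, not_forall] at hr
  obtain ⟨a, ha, hna⟩ := hr
  have hit : ∀ m, ∃ b, (a, b) ∈ iterateOfNotRange τ m := by
    intro m
    induction m with
    | zero => exact ⟨a, rfl, hna⟩
    | succ m ih =>
      obtain ⟨b, hb⟩ := ih
      obtain ⟨b', hb'⟩ := hl b (((hP m).fibre_eq hb).symm.trans ha)
      exact ⟨b', b, hb, hb'⟩
  choose f hf using hit
  -- Pigeonhole: among the infinitely many iterates of `a`, infinitely many share an index. That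
  -- index may vary with `c`, hence the gluing above.
  obtain ⟨i, hi⟩ := Finite.exists_infinite_fiber fun m => (⟨idx (f m), hlt _⟩ : Fin n)
  have hc : ∃ i, LeftTotal v (M i) c := by
    refine ⟨i, ha ▸ hMt i a ?_⟩
    refine (Set.infinite_coe_iff.1 hi).mono ?_
    rintro m hm
    exact ⟨_, f m, hf m, congrArg Fin.val hm, rfl⟩
  obtain ⟨j, hj, hNj⟩ := hNt c hc
  intro z hz
  obtain ⟨y, hy⟩ := hj z hz
  exact ⟨y, (hNj z y hz).2 hy⟩

end Absorption

/-! ### Cancelling finite fibres of bounded size -/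

section Cancellation

variable {Z W X Q : Type*} [MeasurableSpace Z] [StandardBorelSpace Z] [MeasurableSpace W]
  [StandardBorelSpace W] [MeasurableSpace X] [StandardBorelSpace X] {q : Z → Q} {r : W → Q}

/-- One half of the cancellation theorem. -/
theorem exists_leftTotal_matching_of_deficient (hZZ : BorelOver q q) (hqr : BorelOver q r)
    {π₁ : X → Z} {π₂ : X → W} (hπ₁ : Measurable π₁) (hπ₂ : Measurable π₂)
    (hs₁ : Function.Surjective π₁) (hπ : ∀ a, q (π₁ a) = r (π₂ a))
    {n : ℕ} {idx : X → ℕ} (hidx : Measurable idx) (hlt : ∀ a, idx a < n)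
    (hinj : ∀ a b, π₂ a = π₂ b → idx a = idx b → a = b)
    {E : Set (X × X)} (hE : MeasurableSet E)
    (h₁₂ : ∀ a z, q z = q (π₁ a) → ∃! b, π₁ b = z ∧ (a, b) ∈ E)
    (h₂₁ : ∀ b y, r y = q (π₁ b) → ∃! a, π₂ a = y ∧ (a, b) ∈ E)
    {M : Set (Z × W)} (hM : IsMatching q r M) :
    ∃ N, IsMatching q r N ∧ ∀ c, RightTotal r M c → ¬ LeftTotal q M c → LeftTotal q N c := by
  have hZX : BorelOver q fun a => q (π₁ a) := by
    refine ⟨?_, hZZ.countable_left, fun c => ?_⟩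
    · exact (measurable_fst.prodMk (hπ₁.comp measurable_snd)) hZZ.borel
    · have : ((fun a => (π₂ a, idx a)) '' ((fun a => q (π₁ a)) ⁻¹' {c})).Countable :=
        ((hqr.countable_right c).prod (countable_univ (α := ℕ))).mono (by
          rintro _ ⟨a, ha, rfl⟩
          exact ⟨(hπ a).symm.trans ha, mem_univ _⟩)
      exact countable_of_injective_of_countable_image (f := fun a => (π₂ a, idx a))
        (fun a _ b _ h => hinj a b (congrArg Prod.fst h) (congrArg Prod.snd h)) this
  -- From `a` project to `W`, cross to `Z` by `M` reversed, and lift to the unique `E`-related point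
  -- of the `π₁`-fibre. Right-totality of `M` makes `τ` total, and an unmatched `z` keeps its whole
  -- `π₁`-fibre out of the range.
  let τ : Set (X × X) := {p | p ∈ E ∧ (π₁ p.2, π₂ p.1) ∈ M}
  have hτ : IsMatching (fun a => q (π₁ a)) (fun a => q (π₁ a)) τ := by
    refine ⟨?_, ?_, ?_, ?_⟩
    · exact hE.inter (((hπ₁.comp measurable_snd).prodMk (hπ₂.comp measurable_fst))
        hM.measurableSet)
    · intro a b h
      exact (hπ a).trans (hM.fibre_eq h.2).symm
    · intro a b b' h h'
      have hb : π₁ b = π₁ b' := hM.left_unique h.2 h'.2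
      exact (h₁₂ a (π₁ b) ((hM.fibre_eq h.2).trans (hπ a).symm)).unique ⟨rfl, h.1⟩ ⟨hb.symm, h'.1⟩
    · intro a a' b h h'
      have ha : π₂ a = π₂ a' := hM.right_unique h.2 h'.2
      exact (h₂₁ b (π₂ a) (hM.fibre_eq h.2).symm).unique ⟨rfl, h.1⟩ ⟨ha.symm, h'.1⟩
  obtain ⟨N, hN, hNt⟩ := exists_absorbing_matching hZX hZZ hτ hπ₂ (fun a => (hπ a).symm) hidx hlt
    hinj
  refine ⟨N, hN, fun c hr hl => hNt c ?_ ?_⟩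
  · intro a ha
    obtain ⟨z, hz⟩ := hr (π₂ a) ((hπ a).symm.trans ha)
    obtain ⟨b, ⟨rfl, hb⟩, -⟩ := h₁₂ a z ((hM.fibre_eq hz).trans (hπ a).symm)
    exact ⟨b, hb, hz⟩
  · intro hr'
    apply hl
    intro z hz
    obtain ⟨b, rfl⟩ := hs₁ z
    obtain ⟨a, -, ha⟩ := hr' b hz
    exact ⟨_, ha⟩

/-- **Cancellation**: if `π₁ : X → Z` and `π₂ : X → W` are surjections over `Q` with finite fibres
of bounded size and fibres over the same point of `Q` are matched by the Borel relation `E`, then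
`Z` and `W` are Borel isomorphic over `Q`. -/
theorem exists_bijective_matching (hZZ : BorelOver q q) (hWW : BorelOver r r)
    (hqr : BorelOver q r) {π₁ : X → Z} {π₂ : X → W} (hπ₁ : Measurable π₁) (hπ₂ : Measurable π₂)
    (hs₁ : Function.Surjective π₁) (hs₂ : Function.Surjective π₂)
    (hπ : ∀ a, q (π₁ a) = r (π₂ a)) {n : ℕ} {idx₁ idx₂ : X → ℕ} (hidx₁ : Measurable idx₁)
    (hidx₂ : Measurable idx₂) (hlt₁ : ∀ a, idx₁ a < n) (hlt₂ : ∀ a, idx₂ a < n)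
    (hinj₁ : ∀ a b, π₁ a = π₁ b → idx₁ a = idx₁ b → a = b)
    (hinj₂ : ∀ a b, π₂ a = π₂ b → idx₂ a = idx₂ b → a = b)
    {E : Set (X × X)} (hE : MeasurableSet E)
    (h₁₂ : ∀ a z, q z = q (π₁ a) → ∃! b, π₁ b = z ∧ (a, b) ∈ E)
    (h₂₁ : ∀ b y, r y = q (π₁ b) → ∃! a, π₂ a = y ∧ (a, b) ∈ E) :
    ∃ M, IsMatching q r M ∧ ∀ c, LeftTotal q M c ∧ RightTotal r M c := by
  obtain ⟨M, hM, hMt⟩ := hqr.exists_maximal_matching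
  obtain ⟨N₁, hN₁, hN₁t⟩ := exists_leftTotal_matching_of_deficient hZZ hqr hπ₁ hπ₂ hs₁ hπ hidx₂
    hlt₂ hinj₂ hE h₁₂ h₂₁ hM
  obtain ⟨N₂, hN₂, hN₂t⟩ := exists_leftTotal_matching_of_deficient hWW hqr.symm hπ₂ hπ₁ hs₂
    (fun a => (hπ a).symm) hidx₁ hlt₁ hinj₁ (measurable_swap hE)
    (fun b y hy => h₂₁ b y (hy.trans (hπ b).symm)) (fun a z hz => h₁₂ a z (hz.trans (hπ a).symm))
    hM.symm
  obtain ⟨B₁, hB₁, hB₁t⟩ := hN₁.schroederBernstein hM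
  obtain ⟨B₂, hB₂, hB₂t⟩ := hM.schroederBernstein hN₂.symm
  have hdich : ∀ c, LeftTotal q M c ∨ RightTotal r M c := by
    intro c
    by_contra hcon
    simp only [LeftTotal, RightTotal, not_or, not_forall] at hcon
    obtain ⟨⟨z, hz, hz'⟩, y, hy, hy'⟩ := hcon
    exact (hMt z y (hz.trans hy.symm)).elim hz' hy'
  -- Three cases over `c`: `M` is already bijective, only right-total (use `B₁`), or only left-total
  -- (use `B₂`). Maximality of `M` excludes a fourth.
  let F : ℕ → Set (Z × W) := fun i => if i = 0 then M else if i = 1 then B₁ else B₂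
  have hF : ∀ i, IsMatching q r (F i) := by
    intro i
    simp only [F]
    split_ifs <;> assumption
  obtain ⟨N, hN, hNt⟩ := exists_glued_matching hF
    (S := fun i => {c | LeftTotal q (F i) c} ∩ {c | RightTotal r (F i) c}) fun i =>
      ((hF i).measurableSet_leftTotal hZZ).inter ((hF i).measurableSet_rightTotal hqr)
  refine ⟨N, hN, fun c => ?_⟩
  have hc : ∃ i, LeftTotal q (F i) c ∧ RightTotal r (F i) c := by
    by_cases hl : LeftTotal q M c <;> by_cases hr : RightTotal r M c
    · exact ⟨0, hl, hr⟩
    · exact ⟨2, hB₂t c hl (hN₂t c hl hr)⟩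
    · exact ⟨1, hB₁t c (hN₁t c hr hl) hr⟩
    · exact ((hdich c).elim hl hr).elim
  obtain ⟨i, ⟨hil, hir⟩, hNi⟩ := hNt c hc
  refine ⟨fun z hz => ?_, fun y hy => ?_⟩
  · obtain ⟨y, hy⟩ := hil z hz
    exact ⟨y, (hNi z y hz).2 hy⟩
  · obtain ⟨z, hz⟩ := hir y hy
    exact ⟨z, (hNi z y (((hF i).fibre_eq hz).trans hy)).2 hz⟩

end Cancellation

/-! ### Borel representatives of an outer action -/

/-- A map with Borel graph is measurable. -/
theorem measurable_of_measurableSet_graph {A B : Type*} [MeasurableSpace A] [StandardBorelSpace A]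
    [MeasurableSpace B] [StandardBorelSpace B] {f : A → B}
    (hf : MeasurableSet {p : A × B | f p.1 = p.2}) : Measurable f := by
  intro S hS
  have := measurableSet_exists_of_unique (P := {p : A × B | f p.1 = p.2 ∧ p.2 ∈ S})
    (hf.inter (measurable_snd hS)) fun a b b' h h' => h.1.symm.trans h'.1
  convert this using 1
  ext a
  simp

namespace CBER

variable {X : Type*} [MeasurableSpace X] {G : Type*} [Group G]

/-- The quotient map by a countable Borel equivalence relation has Borel kernel and countable
fibres. -/
theorem borelOver_mk (E : CBER X) :
    BorelOver (Quotient.mk E.toSetoid) (Quotient.mk E.toSetoid) := by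
  have hc : ∀ c, (Quotient.mk E.toSetoid ⁻¹' {c}).Countable := by
    intro c
    induction c using Quotient.inductionOn with
    | h x =>
      refine (E.countable_classes x).mono fun y hy => ?_
      exact E.toSetoid.symm (Quotient.exact hy)
  refine ⟨?_, hc, hc⟩
  convert E.borel using 1
  ext p
  exact Quotient.eq

theorem measurableSet_rel (E : CBER X) {A : Type*} [MeasurableSpace A] {f h : A → X}
    (hf : Measurable f) (hh : Measurable h) : MeasurableSet {a | E.toSetoid (f a) (h a)} :=
  (hf.prodMk hh) E.borel

/-- `t` chooses a Borel automorphism `t g` in the class `b g` for each `g`. -/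
structure IsOuterRep (E : CBER X) (b : G →* E.Out) (t : G → X → X) : Prop where
  measurable : ∀ g, Measurable (t g)
  bijective : ∀ g, Function.Bijective (t g)
  rel_iff : ∀ g {x y}, E.toSetoid x y ↔ E.toSetoid (t g x) (t g y)
  rel_mul : ∀ g h x, E.toSetoid (t g (t h x)) (t (g * h) x)
  rel_one : ∀ x, E.toSetoid (t 1 x) x
  toOut_eq_iff : ∀ (S : E.Aut) g, E.toOut S = b g ↔ ∀ x, E.toSetoid (t g x) (S.1 x)

theorem toOut_eq_toOut_iff (E : CBER X) (S T : E.Aut) :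
    E.toOut S = E.toOut T ↔ ∀ x, E.toSetoid (T.1 x) (S.1 x) := by
  have h : E.toOut S = E.toOut T ↔ S⁻¹ * T ∈ E.Inn := QuotientGroup.eq
  rw [h]
  refine forall_congr' fun x => ?_
  have h2 : S.1 ((S⁻¹ * T).1 x) = T.1 x := by
    show S.1 (S.1.symm (T.1 x)) = T.1 x
    simp
  rw [S.2.2.2, h2]
  exact ⟨fun h => E.toSetoid.symm h, fun h => E.toSetoid.symm h⟩

theorem exists_isOuterRep (E : CBER X) (b : G →* E.Out) : ∃ t, E.IsOuterRep b t := by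
  have hs : ∀ g, ∃ T : E.Aut, E.toOut T = b g := fun g => QuotientGroup.mk_surjective _
  choose T hT using hs
  refine ⟨fun g => (T g).1, fun g => (T g).2.1, fun g => (T g).1.bijective,
    fun g x y => (T g).2.2.2 x y, fun g h x => ?_, fun x => ?_, fun S g => ?_⟩
  · have : E.toOut (T (g * h)) = E.toOut (T g * T h) := by
      rw [map_mul, hT, hT, hT, map_mul]
    exact (toOut_eq_toOut_iff E _ _).1 this x
  · have : E.toOut 1 = E.toOut (T 1) := by
      rw [map_one, hT, map_one]
    exact (toOut_eq_toOut_iff E _ _).1 this x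
  · rw [← hT g, toOut_eq_toOut_iff]

namespace IsOuterRep

variable {E : CBER X} {b : G →* E.Out} {t : G → X → X}

theorem rel_mul_of_rel (ht : E.IsOuterRep b t) {g h : G} {x y : X}
    (hxy : E.toSetoid (t h x) y) : E.toSetoid (t (g * h) x) (t g y) :=
  E.toSetoid.trans (E.toSetoid.symm (ht.rel_mul g h x)) ((ht.rel_iff g).1 hxy)

theorem rel_inv (ht : E.IsOuterRep b t) {g : G} {x y : X} (hxy : E.toSetoid (t g x) y) :
    E.toSetoid (t g⁻¹ y) x := by
  have := ht.rel_mul_of_rel (g := g⁻¹) hxy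
  rw [inv_mul_cancel] at this
  exact E.toSetoid.trans (E.toSetoid.symm this) (ht.rel_one x)

/-- A coherent family of Borel relations containing exactly one pair `(x, y)` with `y` in the class
`b g [x]` defines a lift of `b`. -/
theorem exists_lift [StandardBorelSpace X] (ht : E.IsOuterRep b t) {K : G → Set (X × X)}
    (hK : ∀ g, MeasurableSet (K g)) (hu : ∀ g x, ∃! y, E.toSetoid (t g x) y ∧ (x, y) ∈ K g)
    (h1 : ∀ x, (x, x) ∈ K 1)
    (hmul : ∀ g h x y z, (x, y) ∈ K h → (y, z) ∈ K g → (x, z) ∈ K (g * h)) :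
    ∃ a : G →* E.Aut, E.IsLift a b ∧
      ∀ g x, E.toSetoid (t g x) ((a g).1 x) ∧ (x, (a g).1 x) ∈ K g := by
  choose f hf hfu using hu
  have hf1 : ∀ x, f 1 x = x := fun x => (hfu 1 x x ⟨ht.rel_one x, h1 x⟩).symm
  have hfm : ∀ g h x, f (g * h) x = f g (f h x) := fun g h x =>
    (hfu (g * h) x _ ⟨E.toSetoid.trans (ht.rel_mul_of_rel (hf h x).1) (hf g (f h x)).1,
      hmul _ _ _ _ _ (hf h x).2 (hf g (f h x)).2⟩).symm
  have hmeas : ∀ g, Measurable (f g) := by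
    intro g
    apply measurable_of_measurableSet_graph
    have : {p : X × X | f g p.1 = p.2} = {p : X × X | E.toSetoid (t g p.1) p.2} ∩ K g := by
      ext ⟨x, y⟩
      constructor
      · intro h
        have h' : f g x = y := h
        subst h'
        exact hf g x
      · exact fun h => (hfu g x y h).symm
    rw [this]
    exact ((((ht.measurable g).comp measurable_fst).prodMk measurable_snd) E.borel).inter (hK g)
  let P : G → Equiv.Perm X := fun g =>
    ⟨f g, f g⁻¹, fun x => by rw [← hfm, inv_mul_cancel, hf1],
      fun x => by rw [← hfm, mul_inv_cancel, hf1]⟩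
  have hP : ∀ g, P g ∈ E.Aut := by
    refine fun g => ⟨hmeas g, hmeas g⁻¹, fun x y => ?_⟩
    rw [ht.rel_iff g]
    exact ⟨fun h => E.toSetoid.trans (E.toSetoid.symm (hf g x).1) (E.toSetoid.trans h (hf g y).1),
      fun h => E.toSetoid.trans (hf g x).1 (E.toSetoid.trans h (E.toSetoid.symm (hf g y).1))⟩
  let a : G →* E.Aut := MonoidHom.mk' (fun g => ⟨P g, hP g⟩) fun g h => by
    apply Subtype.ext
    ext x
    exact hfm g h x
  refine ⟨a, ?_, fun g x => hf g x⟩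
  ext g
  exact (ht.toOut_eq_iff (a g) g).2 fun x => (hf g x).1

end IsOuterRep

end CBER

/-! ### Maximal families of disjoint tuples -/

/-- A Borel set of finite tuples in which every point lies in only countably many tuples contains a
maximal Borel subset of tuples with disjoint ranges. -/
theorem exists_maximal_disjoint_tuples {X : Type*} [MeasurableSpace X] [StandardBorelSpace X]
    {G : Type*} [Finite G] [Nonempty G] {W : Set (G → X)} (hW : MeasurableSet W)
    (hc : ∀ g x, {w | w ∈ W ∧ w g = x}.Countable) :
    ∃ M, MeasurableSet M ∧ M ⊆ W ∧ (∀ w ∈ M, ∀ w' ∈ M, ∀ g h, w g = w' h → w = w') ∧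
      ∀ w ∈ W, ∃ w' ∈ M, ∃ g h, w g = w' h := by
  classical
  have hcov : ∀ g, ∃ f : ℕ → Set (X × (G → X)), (∀ n, MeasurableSet (f n)) ∧
      (∀ n, f n ⊆ {p | p.2 ∈ W ∧ p.2 g = p.1}) ∧
      (∀ n a b b', (a, b) ∈ f n → (a, b') ∈ f n → b = b') ∧
      ∀ p ∈ {p : X × (G → X) | p.2 ∈ W ∧ p.2 g = p.1}, ∃ n, p ∈ f n := fun g =>
    exists_cover_functional ((measurable_snd hW).inter
      (measurableSet_eq_fun ((measurable_pi_apply g).comp measurable_snd) measurable_fst))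
      fun x => hc g x
  choose f hf hfP hfu hfc using hcov
  let e : X → ℕ → Bool := MeasurableSpace.mapNatBool X
  have he : Measurable e := MeasurableSpace.measurable_mapNatBool X
  have hei : Function.Injective e := MeasurableSpace.injective_mapNatBool X
  -- A countable description of a pair: `none` records equality, `some` a binary digit that
  -- distinguishes the first point from the second.
  let D : Option (ℕ × Bool) → Set (X × X) := fun o =>
    o.elim {p | p.1 = p.2} fun c => {p | e p.1 c.1 = c.2 ∧ e p.2 c.1 ≠ c.2}
  have hev : ∀ c : ℕ × Bool, MeasurableSet {x | e x c.1 = c.2} := fun c =>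
    ((measurable_pi_apply c.1).comp he) (measurableSet_singleton c.2)
  have hD : ∀ o, MeasurableSet (D o) := by
    rintro (_ | c)
    · exact measurableSet_eq_fun measurable_fst measurable_snd
    · exact (measurable_fst (hev c)).inter (measurable_snd (hev c)).compl
  -- A countable colouring with disjoint tuples in each colour. Let `w g = w' h`. If the colour
  -- separates slots `g` and `h`, a digit of this common point would differ from itself; otherwise
  -- `w' g = w g`, and functionality of `f g` gives `w = w'`.
  let P : (G → ℕ) × (G × G → Option (ℕ × Bool)) → Set (G → X) := fun i =>
    {w | (∀ g, (w g, w) ∈ f g (i.1 g)) ∧ ∀ k : G × G, (w k.1, w k.2) ∈ D (i.2 k)}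
  have hP : ∀ i, MeasurableSet (P i) := by
    intro i
    refine MeasurableSet.inter (s₁ := {w | ∀ g, (w g, w) ∈ f g (i.1 g)})
      (s₂ := {w | ∀ k : G × G, (w k.1, w k.2) ∈ D (i.2 k)}) ?_ ?_
    · simp only [ofPred_forall]
      exact MeasurableSet.iInter fun g =>
        ((measurable_pi_apply g).prodMk measurable_id) (hf g (i.1 g))
    · simp only [ofPred_forall]
      exact MeasurableSet.iInter fun k =>
        ((measurable_pi_apply k.1).prodMk (measurable_pi_apply k.2)) (hD (i.2 k))
  have hPd : ∀ i, ∀ w ∈ P i, ∀ w' ∈ P i, ∀ g h, w g = w' h → w = w' := by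
    intro i w hw w' hw' g h hgh
    have h1 := hw.2 (g, h)
    have h2 := hw'.2 (g, h)
    rcases ho : i.2 (g, h) with _ | c
    · rw [ho] at h1 h2
      have h2' : w' g = w' h := h2
      have h3 := hw'.1 g
      rw [h2', ← hgh] at h3
      exact hfu g _ _ _ _ (hw.1 g) h3
    · rw [ho] at h1 h2
      exact (h2.2 (hgh ▸ h1.1)).elim
  have hPc : ∀ w ∈ W, ∃ i, w ∈ P i := by
    intro w hw
    have h1 : ∀ g, ∃ n, (w g, w) ∈ f g n := fun g => hfc g _ ⟨hw, rfl⟩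
    have h2 : ∀ k : G × G, ∃ o, (w k.1, w k.2) ∈ D o := by
      intro k
      by_cases hk : w k.1 = w k.2
      · exact ⟨none, hk⟩
      · obtain ⟨n, hn⟩ := Function.ne_iff.1 (hei.ne hk)
        exact ⟨some (n, e (w k.1) n), rfl, hn.symm⟩
    choose n hn using h1
    choose o ho using h2
    exact ⟨(n, o), hn, ho⟩
  obtain ⟨s, hs⟩ := exists_surjective_nat ((G → ℕ) × (G × G → Option (ℕ × Bool)))
  let M : ℕ → Set (G → X) := fun n => Nat.rec ∅ (fun n M => M ∪
    (P (s n) ∩ {w | ¬ ∃ w' ∈ M, ∃ g h, w g = w' h})) n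
  have hMs : ∀ n, M (n + 1) = M n ∪ (P (s n) ∩ {w | ¬ ∃ w' ∈ M n, ∃ g h, w g = w' h}) :=
    fun n => rfl
  have hPW : ∀ i, P i ⊆ W := fun i w hw => (hfP (Classical.arbitrary G) _ (hw.1 _)).1
  have hMW : ∀ n, M n ⊆ W := by
    intro n
    induction n with
    | zero => exact empty_subset _
    | succ n ih => exact union_subset ih (inter_subset_left.trans (hPW _))
  have hM : ∀ n, MeasurableSet (M n) := by
    intro n
    induction n with
    | zero => exact MeasurableSet.empty
    | succ n ih =>
      rw [hMs]
      refine ih.union ((hP _).inter (MeasurableSet.compl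
        (s := {w : G → X | ∃ w' ∈ M n, ∃ g h, w g = w' h}) ?_))
      have : {w : G → X | ∃ w' ∈ M n, ∃ g h, w g = w' h} =
          ⋃ g, ⋃ h, (fun w : G → X => w g) ⁻¹' {x | ∃ w', w' ∈ M n ∧ w' h = x} := by
        ext w
        simp only [mem_ofPred_eq, mem_iUnion, mem_preimage]
        constructor
        · rintro ⟨w', hw', g, h, hgh⟩
          exact ⟨g, h, w', hw', hgh.symm⟩
        · rintro ⟨g, h, w', hw', hgh⟩
          exact ⟨w', hw', g, h, hgh.symm⟩
      rw [this]
      refine MeasurableSet.iUnion fun g => MeasurableSet.iUnion fun h => measurable_pi_apply g ?_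
      exact measurableSet_exists_of_countable (P := {p : X × (G → X) | p.2 ∈ M n ∧ p.2 h = p.1})
        ((measurable_snd ih).inter
          (measurableSet_eq_fun ((measurable_pi_apply h).comp measurable_snd) measurable_fst))
        fun x => (hc h x).mono fun w (hw : w ∈ M n ∧ w h = x) =>
          show w ∈ W ∧ w h = x from ⟨hMW n hw.1, hw.2⟩
  have hMd : ∀ n, ∀ w ∈ M n, ∀ w' ∈ M n, ∀ g h, w g = w' h → w = w' := by
    intro n
    induction n with
    | zero => exact fun w hw => hw.elim
    | succ n ih =>
      rintro w (hw | hw) w' (hw' | hw') g h hgh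
      · exact ih w hw w' hw' g h hgh
      · exact (hw'.2 ⟨w, hw, h, g, hgh.symm⟩).elim
      · exact (hw.2 ⟨w', hw', g, h, hgh⟩).elim
      · exact hPd _ w hw.1 w' hw'.1 g h hgh
  have hmono : Monotone M := monotone_nat_of_le_succ fun n => by
    rw [hMs]
    exact subset_union_left
  refine ⟨⋃ n, M n, MeasurableSet.iUnion hM, iUnion_subset hMW, ?_, ?_⟩
  · intro w hw w' hw' g h hgh
    obtain ⟨n, hn⟩ := mem_iUnion.1 hw
    obtain ⟨m, hm⟩ := mem_iUnion.1 hw'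
    exact hMd (max n m) w (hmono (le_max_left _ _) hn) w' (hmono (le_max_right _ _) hm) g h hgh
  · intro w hw
    obtain ⟨i, hi⟩ := hPc w hw
    obtain ⟨n, rfl⟩ := hs i
    rcases Classical.em (∃ w' ∈ M n, ∃ g h, w g = w' h) with hex | hex
    · obtain ⟨w', hw', hgh⟩ := hex
      exact ⟨w', mem_iUnion.2 ⟨n, hw'⟩, hgh⟩
    · refine ⟨w, mem_iUnion.2 ⟨n + 1, ?_⟩, Classical.arbitrary G, Classical.arbitrary G, rfl⟩
      rw [hMs]
      exact Or.inr ⟨hi, hex⟩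

namespace CBER.IsOuterRep

variable {X : Type*} [MeasurableSpace X] {G : Type*} [Group G]
  {E : CBER X} {b : G →* E.Out} {t : G → X → X}

/-! ### Outer actions of finite groups -/

/-- Some point of `[t g x]` lies outside `A`. -/
def Exits (E : CBER X) (t : G → X → X) (A : Set X) (g : G) (x : X) : Prop :=
  ∃ y, E.toSetoid (t g x) y ∧ y ∉ A

theorem Exits.congr (ht : E.IsOuterRep b t) {A : Set X} {g h : G} {x y : X}
    (hxy : E.toSetoid (t h x) y) : Exits E t A g y ↔ Exits E t A (g * h) x := by
  have := ht.rel_mul_of_rel (g := g) hxy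
  exact ⟨fun ⟨z, hz, hzA⟩ => ⟨z, E.toSetoid.trans this hz, hzA⟩,
    fun ⟨z, hz, hzA⟩ => ⟨z, E.toSetoid.trans (E.toSetoid.symm this) hz, hzA⟩⟩

theorem Exits.congr_rel (ht : E.IsOuterRep b t) {A : Set X} {g : G} {x y : X}
    (hxy : E.toSetoid x y) : Exits E t A g y ↔ Exits E t A g x := by
  have := Exits.congr (A := A) (g := g) ht (E.toSetoid.trans (ht.rel_one x) hxy)
  rwa [mul_one] at this

/-- Right translation by `h` reindexes the classes of the same orbit, so having an uncovered class
is a property of the orbit. -/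
theorem exists_exits_congr (ht : E.IsOuterRep b t) {A : Set X} {h : G} {x y : X}
    (hxy : E.toSetoid (t h x) y) : (∃ g, Exits E t A g y) ↔ ∃ g, Exits E t A g x := by
  constructor
  · rintro ⟨g, hg⟩
    exact ⟨_, (Exits.congr ht hxy).1 hg⟩
  · rintro ⟨g, hg⟩
    refine ⟨g * h⁻¹, (Exits.congr ht hxy).2 ?_⟩
    rwa [inv_mul_cancel_right]

variable [StandardBorelSpace X]

theorem measurableSet_exits (ht : E.IsOuterRep b t) {A : Set X} (hA : MeasurableSet A) (g : G) :
    MeasurableSet {x | Exits E t A g x} :=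
  measurableSet_exists_of_countable (P := {p : X × X | E.toSetoid (t g p.1) p.2 ∧ p.2 ∉ A})
    (((((ht.measurable g).comp measurable_fst).prodMk measurable_snd) E.borel).inter
      (measurable_snd hA.compl)) fun x => (E.countable_classes (t g x)).mono fun _ h => h.1

/-- There is a Borel partial partition of `X` into transversals of the classes of an outer action of
a finite group which is maximal: in every orbit some class is entirely covered. -/
theorem exists_maximal_transversals [Finite G] (ht : E.IsOuterRep b t) :
    ∃ S : Set (X × X), MeasurableSet S ∧ (∀ x y, (x, y) ∈ S → (x, x) ∈ S ∧ (y, x) ∈ S) ∧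
      (∀ x y z, (x, y) ∈ S → (y, z) ∈ S → (x, z) ∈ S) ∧
      (∀ x y, (x, y) ∈ S → E.toSetoid x y → x = y) ∧
      (∀ g x, (x, x) ∈ S → ∃ y, (x, y) ∈ S ∧ E.toSetoid (t g x) y) ∧
      ∀ x, ∃ g, ¬ Exits E t {y | (y, y) ∈ S} g x := by
  classical
  -- The outer action need not be free, so slots landing in the same class are required to hold the
  -- same point; ranges are then transversals.
  let W : Set (G → X) := {w | (∀ g, E.toSetoid (t g (w 1)) (w g)) ∧
    ∀ k : G × G, E.toSetoid (w k.1) (w k.2) → w k.1 = w k.2}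
  have hev : ∀ g, Measurable fun w : G → X => w g := fun g => measurable_pi_apply g
  have hW : MeasurableSet W := by
    refine MeasurableSet.inter (s₁ := {w : G → X | ∀ g, E.toSetoid (t g (w 1)) (w g)})
      (s₂ := {w | ∀ k : G × G, E.toSetoid (w k.1) (w k.2) → w k.1 = w k.2}) ?_ ?_
    · simp only [ofPred_forall]
      exact MeasurableSet.iInter fun g =>
        E.measurableSet_rel ((ht.measurable g).comp (hev 1)) (hev g)
    · simp only [ofPred_forall]
      refine MeasurableSet.iInter fun k => ?_
      have : {w : G → X | E.toSetoid (w k.1) (w k.2) → w k.1 = w k.2} =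
          {w | E.toSetoid (w k.1) (w k.2)}ᶜ ∪ {w | w k.1 = w k.2} := by
        ext w
        exact imp_iff_not_or
      rw [this]
      exact (E.measurableSet_rel (hev k.1) (hev k.2)).compl.union
        (measurableSet_eq_fun (hev k.1) (hev k.2))
  have hrel : ∀ w ∈ W, ∀ g h, E.toSetoid (t (h * g⁻¹) (w g)) (w h) := fun w hw g h =>
    E.toSetoid.trans (ht.rel_mul_of_rel (ht.rel_inv (hw.1 g))) (hw.1 h)
  have hc : ∀ g x, {w | w ∈ W ∧ w g = x}.Countable := by
    intro g x
    refine (Set.countable_pi (s := fun h => {y | E.toSetoid (t (h * g⁻¹) x) y})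
      fun h => E.countable_classes _).mono ?_
    rintro w ⟨hw, rfl⟩ h
    exact hrel w hw g h
  obtain ⟨M, hM, hMW, hMd, hMm⟩ := exists_maximal_disjoint_tuples hW hc
  refine ⟨{p | ∃ w ∈ M, ∃ g h, w g = p.1 ∧ w h = p.2}, ?_, ?_, ?_, ?_, ?_, ?_⟩
  · have : {p : X × X | ∃ w ∈ M, ∃ g h, w g = p.1 ∧ w h = p.2} =
        ⋃ g, ⋃ h, {p : X × X | ∃ w, w ∈ M ∧ w g = p.1 ∧ w h = p.2} := by
      ext p
      simp only [mem_ofPred_eq, mem_iUnion]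
      constructor
      · rintro ⟨w, hw, g, h, hgh⟩
        exact ⟨g, h, w, hw, hgh⟩
      · rintro ⟨g, h, w, hw, hgh⟩
        exact ⟨w, hw, g, h, hgh⟩
    rw [this]
    refine MeasurableSet.iUnion fun g => MeasurableSet.iUnion fun h => ?_
    refine measurableSet_exists_of_unique
      (P := {p : (X × X) × (G → X) | p.2 ∈ M ∧ p.2 g = p.1.1 ∧ p.2 h = p.1.2}) ?_
      fun p w w' hw hw' => hMd w hw.1 w' hw'.1 g g (hw.2.1.trans hw'.2.1.symm)
    have h1 : MeasurableSet {p : (X × X) × (G → X) | p.2 g = p.1.1} :=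
      measurableSet_eq_fun ((hev g).comp measurable_snd) (by fun_prop)
    have h2 : MeasurableSet {p : (X × X) × (G → X) | p.2 h = p.1.2} :=
      measurableSet_eq_fun ((hev h).comp measurable_snd) (by fun_prop)
    exact (measurable_snd hM).inter (h1.inter h2)
  · rintro x y ⟨w, hw, g, h, hg, hh⟩
    exact ⟨⟨w, hw, g, g, hg, hg⟩, ⟨w, hw, h, g, hh, hg⟩⟩
  · rintro x y z ⟨w, hw, g, h, hg, hh⟩ ⟨w', hw', g', h', hg', hh'⟩
    obtain rfl := hMd w hw w' hw' h g' (hh.trans hg'.symm)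
    exact ⟨w, hw, g, h', hg, hh'⟩
  · rintro _ _ ⟨w, hw, g, h, rfl, rfl⟩ hE
    exact (hMW hw).2 (g, h) hE
  · rintro k _ ⟨w, hw, g, h, rfl, hh⟩
    refine ⟨w (k * g), ⟨w, hw, g, k * g, rfl, rfl⟩, ?_⟩
    have := hrel w (hMW hw) g (k * g)
    rwa [mul_inv_cancel_right] at this
  · intro x
    by_contra hcon
    push Not at hcon
    let A : Set X := {y | ∃ w ∈ M, ∃ g h, w g = y ∧ w h = y}
    -- If every class of the orbit had an uncovered point, choosing one per class would give a tuple
    -- of `W` disjoint from all of `M`. The value `x` is a junk default.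
    let c : Quotient E.toSetoid → X := fun q =>
      if h : ∃ y, Quotient.mk E.toSetoid y = q ∧ y ∉ A then h.choose else x
    have hcs : ∀ g, Quotient.mk E.toSetoid (c (Quotient.mk E.toSetoid (t g x))) =
        Quotient.mk E.toSetoid (t g x) ∧ c (Quotient.mk E.toSetoid (t g x)) ∉ A := by
      intro g
      obtain ⟨y, hy, hyA⟩ := hcon g
      have h : ∃ y, Quotient.mk E.toSetoid y = Quotient.mk E.toSetoid (t g x) ∧ y ∉ A :=
        ⟨y, (Quotient.sound hy).symm, hyA⟩
      simp only [c, dif_pos h]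
      exact h.choose_spec
    let w : G → X := fun g => c (Quotient.mk E.toSetoid (t g x))
    have hwx : ∀ g, E.toSetoid (t g x) (w g) := fun g =>
      E.toSetoid.symm (Quotient.exact (hcs g).1)
    have hw : w ∈ W := by
      refine ⟨fun g => ?_, fun k hk => ?_⟩
      · have h1 : E.toSetoid x (w 1) :=
          E.toSetoid.trans (E.toSetoid.symm (ht.rel_one x)) (hwx 1)
        exact E.toSetoid.trans (E.toSetoid.symm ((ht.rel_iff g).1 h1)) (hwx g)
      · have : Quotient.mk E.toSetoid (t k.1 x) = Quotient.mk E.toSetoid (t k.2 x) :=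
          Quotient.sound (E.toSetoid.trans (hwx k.1)
            (E.toSetoid.trans hk (E.toSetoid.symm (hwx k.2))))
        exact congrArg c this
    obtain ⟨w', hw', g, h, hgh⟩ := hMm w hw
    exact (hcs g).2 ⟨w', hw', h, h, hgh.symm, hgh.symm⟩

end CBER.IsOuterRep

/-- A nonempty predicate has a unique minimizer of an injective function to `ℕ`. -/
theorem existsUnique_minimizer {G : Type*} {ord : G → ℕ} (ho : Function.Injective ord)
    {P : G → Prop} (hP : ∃ g, P g) : ∃! g, P g ∧ ∀ k, P k → ord g ≤ ord k := by
  classical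
  have hex : ∃ n, ∃ g, P g ∧ ord g = n := hP.elim fun g hg => ⟨_, g, hg, rfl⟩
  obtain ⟨g, hg, hgn⟩ := Nat.find_spec hex
  refine ⟨g, ⟨hg, fun k hk => hgn.trans_le (Nat.find_min' hex ⟨k, hk, rfl⟩)⟩, fun k hk => ?_⟩
  exact ho (le_antisymm (hk.2 g hg) (hgn.trans_le (Nat.find_min' hex ⟨k, hk.1, rfl⟩)))

/-! ### Compression of uncovered orbits, and the canonical model -/

namespace CBER.IsOuterRep

variable {X : Type*} [MeasurableSpace X] [StandardBorelSpace X] {G : Type*} [Group G]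
  {E : CBER X} {b : G →* E.Out} {t : G → X → X}

/-- The classes which do not split into the given transversals are compressible. -/
theorem exists_compression [Finite G] (ht : E.IsOuterRep b t) {S : Set (X × X)}
    (hS : MeasurableSet S) (hsymm : ∀ x y, (x, y) ∈ S → (x, x) ∈ S ∧ (y, x) ∈ S)
    (htrans : ∀ x y z, (x, y) ∈ S → (y, z) ∈ S → (x, z) ∈ S)
    (heq : ∀ x y, (x, y) ∈ S → E.toSetoid x y → x = y)
    (hmeet : ∀ g x, (x, x) ∈ S → ∃ y, (x, y) ∈ S ∧ E.toSetoid (t g x) y)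
    (hmax : ∀ x, ∃ g, ¬ Exits E t {y | (y, y) ∈ S} g x) :
    ∃ τ, IsMatching (Quotient.mk E.toSetoid) (Quotient.mk E.toSetoid) τ ∧
      ∀ x, (∃ g, Exits E t {y | (y, y) ∈ S} g x) →
        LeftTotal (Quotient.mk E.toSetoid) τ (Quotient.mk E.toSetoid x) ∧
        ¬ RightTotal (Quotient.mk E.toSetoid) τ (Quotient.mk E.toSetoid x) := by
  obtain ⟨ord, ho⟩ := Countable.exists_injective_nat G
  set A : Set X := {y | (y, y) ∈ S} with hAdef
  have hA : MeasurableSet A := (measurable_id.prodMk measurable_id) hS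
  have hAe := ht.measurableSet_exits hA
  -- `P` picks the first `n` with `n[x]` fully covered, `R` the first `m` with `m[x]` not fully
  -- covered; both depend only on the `E`-class of `x`.
  let P : G → X → Prop := fun n x => ¬ Exits E t A n x ∧ ∀ k, ¬ Exits E t A k x → ord n ≤ ord k
  let R : G → X → Prop := fun m x => Exits E t A m x ∧ ∀ k, Exits E t A k x → ord m ≤ ord k
  have hPm : ∀ n, MeasurableSet {x | P n x} := by
    intro n
    refine (hAe n).compl.inter (MeasurableSet.congr (MeasurableSet.iInter fun k =>
      (hAe k).union (MeasurableSet.const (ord n ≤ ord k))) ?_)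
    ext x
    simp only [mem_iInter, mem_union, mem_ofPred_eq]
    exact forall_congr' fun k => or_iff_not_imp_left
  have hRm : ∀ n, MeasurableSet {x | R n x} := by
    intro n
    refine (hAe n).inter (MeasurableSet.congr (MeasurableSet.iInter fun k =>
      (hAe k).compl.union (MeasurableSet.const (ord n ≤ ord k))) ?_)
    ext x
    simp only [mem_iInter, mem_union, mem_ofPred_eq, mem_compl_iff]
    exact forall_congr' fun k => imp_iff_not_or.symm
  have hPc : ∀ {n x y}, E.toSetoid x y → P n y → P n x := by
    intro n x y hxy h
    exact ⟨fun h' => h.1 ((Exits.congr_rel ht hxy).2 h'),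
      fun k hk => h.2 k fun h' => hk ((Exits.congr_rel ht hxy).1 h')⟩
  have hRc : ∀ {n x y}, E.toSetoid x y → R n y → R n x := by
    intro n x y hxy h
    exact ⟨(Exits.congr_rel ht hxy).1 h.1, fun k hk => h.2 k ((Exits.congr_rel ht hxy).2 hk)⟩
  have hPu : ∀ {n n' x}, P n x → P n' x → n = n' := fun h h' =>
    ho (le_antisymm (h.2 _ h'.1) (h'.2 _ h.1))
  have hRu : ∀ {n n' x}, R n x → R n' x → n = n' := fun h h' =>
    ho (le_antisymm (h.2 _ h'.1) (h'.2 _ h.1))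
  have hPex : ∀ x, ∃ n, P n x := fun x => (existsUnique_minimizer ho (hmax x)).exists
  -- Carry `[x]` onto the covered class by `t n`, slide along the transversals into the uncovered
  -- class, and return by the inverse of `t m`. Points whose `t m`-image is uncovered are missed.
  let τ : Set (X × X) := {p | E.toSetoid p.1 p.2 ∧
    ∃ n m, P n p.1 ∧ R m p.1 ∧ (t n p.1, t m p.2) ∈ S}
  have hτ : IsMatching (Quotient.mk E.toSetoid) (Quotient.mk E.toSetoid) τ := by
    refine ⟨?_, fun h => Quotient.sound h.1, ?_, ?_⟩
    · refine E.borel.inter (MeasurableSet.congr (MeasurableSet.iUnion fun n =>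
        MeasurableSet.iUnion fun m => (measurable_fst (hPm n)).inter
          ((measurable_fst (hRm m)).inter ((((ht.measurable n).comp measurable_fst).prodMk
            ((ht.measurable m).comp measurable_snd)) hS))) ?_)
      ext p
      simp only [mem_iUnion]
      rfl
    · rintro z w w' ⟨hzw, n, m, hn, hm, h⟩ ⟨hzw', n', m', hn', hm', h'⟩
      obtain rfl := hPu hn hn'
      obtain rfl := hRu hm hm'
      exact (ht.bijective m).1 (heq _ _ (htrans _ _ _ (hsymm _ _ h).2 h') ((ht.rel_iff m).1
        (E.toSetoid.trans (E.toSetoid.symm hzw) hzw')))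
    · rintro z z' w ⟨hzw, n, m, hn, hm, h⟩ ⟨hzw', n', m', hn', hm', h'⟩
      have hzz : E.toSetoid z z' := E.toSetoid.trans hzw (E.toSetoid.symm hzw')
      obtain rfl := hPu hn (hPc hzz hn')
      obtain rfl := hRu hm (hRc hzz hm')
      exact (ht.bijective n).1 (heq _ _ (htrans _ _ _ h (hsymm _ _ h').2) ((ht.rel_iff n).1 hzz))
  refine ⟨τ, hτ, fun x hx => ?_⟩
  obtain ⟨m, hm⟩ := (existsUnique_minimizer ho hx).exists
  refine ⟨fun z hz => ?_, fun hr => ?_⟩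
  · have hzx : E.toSetoid z x := Quotient.exact hz
    obtain ⟨n, hn⟩ := hPex z
    have hnA : t n z ∈ A := by
      by_contra hcon
      exact hn.1 ⟨_, E.toSetoid.refl _, hcon⟩
    obtain ⟨y, hy, hyE⟩ := hmeet (m * n⁻¹) _ hnA
    obtain ⟨z', rfl⟩ := (ht.bijective m).2 y
    have h1 := ht.rel_mul (m * n⁻¹) n z
    rw [inv_mul_cancel_right] at h1
    exact ⟨z', (ht.rel_iff m).2 (E.toSetoid.trans (E.toSetoid.symm h1) hyE), n, m, hn,
      hRc hzx hm, hy⟩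
  · obtain ⟨y, hy, hyA⟩ := hm.1
    obtain ⟨x', rfl⟩ := (ht.bijective m).2 y
    have hxx : E.toSetoid x x' := (ht.rel_iff m).2 hy
    obtain ⟨z, hz, n, m', -, hm', h⟩ := hr x' (Quotient.sound (E.toSetoid.symm hxx))
    obtain rfl := hRu hm (hRc (E.toSetoid.trans hxx (E.toSetoid.symm hz)) hm')
    exact hyA (hsymm _ _ (hsymm _ _ h).2).1

/-- Pairs `(x, g)` with `g` minimal among the elements moving the class of `x` in the same way. -/
def cosetPairs (E : CBER X) (t : G → X → X) (ord : G → ℕ) : Set (X × G) :=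
  {p | ∀ k, E.toSetoid (t k p.1) (t p.2 p.1) → ord p.2 ≤ ord k}

/-- The outer action restricted to the union of the compressible classes is, up to a Borel
isomorphism over `X / E`, the canonical one on pairs `(x, g • [x])`. -/
theorem exists_cosetPairs_matching [Countable G] [MeasurableSpace G] [DiscreteMeasurableSpace G]
    (ht : E.IsOuterRep b t) {ord : G → ℕ} (ho : Function.Injective ord) {τ : Set (X × X)}
    (hτ : IsMatching (Quotient.mk E.toSetoid) (Quotient.mk E.toSetoid) τ) :
    ∃ B : Set (cosetPairs E t ord × X),
      IsMatching (fun p => Quotient.mk E.toSetoid (t p.1.2 p.1.1)) (Quotient.mk E.toSetoid) B ∧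
      MeasurableSet (cosetPairs E t ord) ∧
      ∀ c, LeftTotal (Quotient.mk E.toSetoid) τ c → ¬ RightTotal (Quotient.mk E.toSetoid) τ c →
        LeftTotal (fun p : cosetPairs E t ord => Quotient.mk E.toSetoid (t p.1.2 p.1.1)) B c ∧
        RightTotal (Quotient.mk E.toSetoid) B c := by
  have hjm : ∀ {A : Type _} [MeasurableSpace A] {f : A → X × G}, Measurable f →
      Measurable fun a => t (f a).2 (f a).1 := by
    intro A _ f hf
    exact (measurable_from_prod_countable_left (f := fun p : X × G => t p.2 p.1)
      fun g => ht.measurable g).comp hf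
  have hV : MeasurableSet (cosetPairs E t ord) := by
    have : cosetPairs E t ord = ⋂ k, ({p : X × G | E.toSetoid (t k p.1) (t p.2 p.1)}ᶜ ∪
        {p | ord p.2 ≤ ord k}) := by
      ext p
      simp only [cosetPairs, mem_ofPred_eq, mem_iInter, mem_union, mem_compl_iff]
      exact forall_congr' fun k => imp_iff_not_or
    rw [this]
    refine MeasurableSet.iInter fun k => MeasurableSet.union (MeasurableSet.compl ?_) ?_
    · exact E.measurableSet_rel ((ht.measurable k).comp measurable_fst) (hjm measurable_id)
    · exact measurable_snd (MeasurableSet.of_discrete (s := {g : G | ord g ≤ ord k}))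
  have := hV.standardBorel
  have hcount : ∀ c, ((fun p : cosetPairs E t ord =>
      Quotient.mk E.toSetoid (t p.1.2 p.1.1)) ⁻¹' {c}).Countable := by
    intro c
    induction c using Quotient.inductionOn with
    | h x =>
      have h1 : (⋃ g : G, (fun y => (y, g)) '' {y | E.toSetoid (t g⁻¹ x) y}).Countable :=
        Set.countable_iUnion fun g => (E.countable_classes _).image _
      refine Set.Countable.mono ?_ (h1.preimage Subtype.val_injective)
      rintro ⟨⟨y, g⟩, hp⟩ hy
      exact mem_iUnion.2 ⟨g, y, ht.rel_inv (Quotient.exact hy), rfl⟩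
  have hVX : BorelOver (fun p : cosetPairs E t ord => Quotient.mk E.toSetoid (t p.1.2 p.1.1))
      (Quotient.mk E.toSetoid) := by
    refine ⟨?_, hcount, E.borelOver_mk.countable_left⟩
    refine MeasurableSet.congr (E.measurableSet_rel (hjm (measurable_subtype_coe.comp
      measurable_fst)) measurable_snd) ?_
    ext p
    exact Quotient.eq.symm
  have hVV : BorelOver (fun p : cosetPairs E t ord => Quotient.mk E.toSetoid (t p.1.2 p.1.1))
      (fun p : cosetPairs E t ord => Quotient.mk E.toSetoid (t p.1.2 p.1.1)) := by
    refine ⟨?_, hcount, hcount⟩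
    refine MeasurableSet.congr (E.measurableSet_rel (hjm (measurable_subtype_coe.comp
      measurable_fst)) (hjm (measurable_subtype_coe.comp measurable_snd))) ?_
    ext p
    exact Quotient.eq.symm
  obtain ⟨M, hM, hMt⟩ := exists_absorbing_matching hVX hVV hτ (w := Quotient.mk E.toSetoid)
    measurable_id (fun _ => rfl) (n := 1) (idx := fun _ => 0) measurable_const (fun _ => one_pos)
    (fun a b h _ => h)
  -- The reverse embedding: `x` corresponds to `(x, g)` with `g` minimal among the elements fixing
  -- the class of `x`.
  let N : Set (cosetPairs E t ord × X) :=
    {p | p.1.1.1 = p.2 ∧ E.toSetoid (t p.1.1.2 p.1.1.1) p.2}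
  have hN : IsMatching (fun p : cosetPairs E t ord => Quotient.mk E.toSetoid (t p.1.2 p.1.1))
      (Quotient.mk E.toSetoid) N := by
    refine ⟨?_, fun h => Quotient.sound h.2, fun h h' => h.1.symm.trans h'.1, ?_⟩
    · exact (measurableSet_eq_fun (by fun_prop) measurable_snd).inter
        (E.measurableSet_rel (hjm (measurable_subtype_coe.comp measurable_fst)) measurable_snd)
    · rintro ⟨⟨x, g⟩, hg⟩ ⟨⟨x', g'⟩, hg'⟩ y ⟨hx, h⟩ ⟨hx', h'⟩
      simp only at hx hx' h h'
      subst hx hx'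
      have : g = g' := ho (le_antisymm
        (hg g' (E.toSetoid.trans h' (E.toSetoid.symm h)))
        (hg' g (E.toSetoid.trans h (E.toSetoid.symm h'))))
      subst this
      rfl
  obtain ⟨B, hB, hBt⟩ := hM.schroederBernstein hN
  refine ⟨B, hB, hV, fun c hl hr => hBt c (hMt c hl hr) fun x _ => ?_⟩
  obtain ⟨g, hg, hgm⟩ := (existsUnique_minimizer (P := fun g => E.toSetoid (t g x) x) ho
    ⟨1, ht.rel_one x⟩).exists
  exact ⟨⟨(x, g), fun k hk => hgm k (E.toSetoid.trans hk hg)⟩, rfl, hg⟩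

end CBER.IsOuterRep

/-- Every outer action of a finite group has a class-bijective lift. -/
theorem CBER.exists_classBijective_lift_of_finite {X : Type*} [MeasurableSpace X]
    [StandardBorelSpace X] {G : Type*} [Group G] [Finite G] (E : CBER X) (b : G →* E.Out) :
    ∃ a : G →* E.Aut, E.IsLift a b ∧ E.IsClassBijective a := by
  obtain ⟨t, ht⟩ := E.exists_isOuterRep b
  obtain ⟨S, hS, hsymm, htrans, heq, hmeet, hmax⟩ := ht.exists_maximal_transversals
  obtain ⟨τ, hτ, hτb⟩ := ht.exists_compression hS hsymm htrans heq hmeet hmax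
  obtain ⟨ord, ho⟩ := Countable.exists_injective_nat G
  let _ : MeasurableSpace G := ⊤
  have : DiscreteMeasurableSpace G := ⟨fun _ => trivial⟩
  obtain ⟨B, hB, hV, hBt⟩ := ht.exists_cosetPairs_matching ho hτ
  have := hV.standardBorel
  set A : Set X := {y | (y, y) ∈ S} with hAdef
  have hA : MeasurableSet A := (measurable_id.prodMk measurable_id) hS
  let bad : Set X := {x | ∃ g, IsOuterRep.Exits E t A g x}
  have hbad : MeasurableSet bad := by
    have : bad = ⋃ g, {x | IsOuterRep.Exits E t A g x} := by
      ext x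
      simp [bad]
    rw [this]
    exact MeasurableSet.iUnion fun g => ht.measurableSet_exits hA g
  have hbadc : ∀ {h x y}, E.toSetoid (t h x) y → (y ∈ bad ↔ x ∈ bad) := fun hxy =>
    IsOuterRep.exists_exits_congr ht hxy
  -- In the model, `h` sends `(x, g)` to `(x, k)` with `k` the minimal name of the class `hg[x]`.
  -- Its orbits are given by equality of the first coordinate, which `L` transports to `X`.
  let L : Set (X × X) := {p | ∃ v : IsOuterRep.cosetPairs E t ord × IsOuterRep.cosetPairs E t ord,
    v.1.1.1 = v.2.1.1 ∧ (v.1, p.1) ∈ B ∧ (v.2, p.2) ∈ B}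
  have hL : MeasurableSet L := by
    refine measurableSet_exists_of_unique (P := {p : (X × X) × (IsOuterRep.cosetPairs E t ord ×
      IsOuterRep.cosetPairs E t ord) |
        p.2.1.1.1 = p.2.2.1.1 ∧ (p.2.1, p.1.1) ∈ B ∧ (p.2.2, p.1.2) ∈ B}) ?_
      fun p v v' h h' => Prod.ext (hB.left_unique h.2.1 h'.2.1) (hB.left_unique h.2.2 h'.2.2)
    refine (measurableSet_eq_fun (by fun_prop) (by fun_prop)).inter (MeasurableSet.inter
      (s₁ := {p : (X × X) × (IsOuterRep.cosetPairs E t ord × IsOuterRep.cosetPairs E t ord) |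
        (p.2.1, p.1.1) ∈ B}) ?_ ?_)
    · exact (by fun_prop : Measurable fun p : (X × X) × (IsOuterRep.cosetPairs E t ord ×
        IsOuterRep.cosetPairs E t ord) => (p.2.1, p.1.1)) hB.measurableSet
    · exact (by fun_prop : Measurable fun p : (X × X) × (IsOuterRep.cosetPairs E t ord ×
        IsOuterRep.cosetPairs E t ord) => (p.2.2, p.1.2)) hB.measurableSet
  have hBrel : ∀ {v x}, (v, x) ∈ B → E.toSetoid (t v.1.2 v.1.1) x := fun h =>
    Quotient.exact (hB.fibre_eq h)
  have hBtot : ∀ x ∈ bad,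
      LeftTotal (fun p : IsOuterRep.cosetPairs E t ord => Quotient.mk E.toSetoid (t p.1.2 p.1.1)) B
        (Quotient.mk E.toSetoid x) ∧
      RightTotal (Quotient.mk E.toSetoid) B (Quotient.mk E.toSetoid x) := fun x hx =>
    hBt _ (hτb x hx).1 (hτb x hx).2
  -- `K` is the orbit relation of the lift to be built, so the same relation serves every group
  -- element.
  let K : Set (X × X) := {p | p.1 ∉ bad ∧ p.2 ∉ bad ∧ p ∈ S ∨ p.1 ∈ bad ∧ p.2 ∈ bad ∧ p ∈ L}
  have hK : MeasurableSet K :=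
    ((measurable_fst hbad.compl).inter ((measurable_snd hbad.compl).inter hS)).union
      ((measurable_fst hbad).inter ((measurable_snd hbad).inter hL))
  have hgood : ∀ x, x ∉ bad → x ∈ A := by
    intro x hx
    by_contra hcon
    exact hx ⟨1, x, ht.rel_one x, hcon⟩
  have hK1 : ∀ x, (x, x) ∈ K := by
    intro x
    by_cases hx : x ∈ bad
    · obtain ⟨v, hv⟩ := (hBtot x hx).2 x rfl
      exact Or.inr ⟨hx, hx, (v, v), rfl, hv, hv⟩
    · exact Or.inl ⟨hx, hx, hgood x hx⟩
  have hKu : ∀ g x, ∃! y, E.toSetoid (t g x) y ∧ (x, y) ∈ K := by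
    intro g x
    by_cases hx : x ∈ bad
    · obtain ⟨v, hv⟩ := (hBtot x hx).2 x rfl
      obtain ⟨k, hk, hkm⟩ := (existsUnique_minimizer ho
        (P := fun k => E.toSetoid (t k v.1.1) (t g x)) ⟨g * v.1.2, ht.rel_mul_of_rel (hBrel hv)⟩).exists
      have hgx : t g x ∈ bad := (hbadc (E.toSetoid.refl _)).2 hx
      let u₀ : IsOuterRep.cosetPairs E t ord :=
        ⟨(v.1.1, k), fun j hj => hkm j (E.toSetoid.trans hj hk)⟩
      obtain ⟨y, hy⟩ := (hBtot _ hgx).1 u₀ (Quotient.sound hk)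
      have hgy : E.toSetoid (t g x) y := E.toSetoid.trans (E.toSetoid.symm hk) (hBrel hy)
      refine ⟨y, ⟨hgy, Or.inr ⟨hx, (hbadc hgy).2 hx, (v, u₀), rfl, hv, hy⟩⟩, ?_⟩
      rintro z ⟨hgz, ⟨hx', -⟩ | ⟨-, hz, ⟨u, u'⟩, huu, hu, hu'⟩⟩
      · exact (hx' hx).elim
      · obtain rfl := hB.left_unique hv hu
        refine hB.right_unique hu' ?_
        have hrel : E.toSetoid (t u'.1.2 u'.1.1) (t k u'.1.1) := by
          have h1 := hBrel hu'
          have h2 : v.1.1 = u'.1.1 := huu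
          rw [h2] at hk
          exact E.toSetoid.trans h1 (E.toSetoid.trans (E.toSetoid.symm hgz) (E.toSetoid.symm hk))
        have hmin := hkm u'.1.2 (by
          have h2 : v.1.1 = u'.1.1 := huu
          rw [h2] at hk ⊢
          exact E.toSetoid.trans hrel hk)
        have hk' : k = u'.1.2 := ho (le_antisymm hmin (u'.2 k (E.toSetoid.symm hrel)))
        convert hy using 2
        exact Subtype.ext (Prod.ext huu.symm hk'.symm)
    · obtain ⟨y, hy, hyE⟩ := hmeet g x (hgood x hx)
      have hyb : y ∉ bad := fun h => hx ((hbadc hyE).1 h)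
      refine ⟨y, ⟨hyE, Or.inl ⟨hx, hyb, hy⟩⟩, ?_⟩
      rintro z ⟨hgz, ⟨-, -, hz⟩ | ⟨hx', -⟩⟩
      · exact heq _ _ (htrans _ _ _ (hsymm _ _ hz).2 hy)
          (E.toSetoid.trans (E.toSetoid.symm hgz) hyE)
      · exact (hx hx').elim
  obtain ⟨a, ha, haK⟩ := ht.exists_lift (K := fun _ => K) (fun _ => hK) hKu hK1 (by
    rintro - - x y z (⟨hx, hy, h⟩ | ⟨hx, hy, ⟨u, v⟩, huv, hu, hv⟩)
      (⟨hy', hz, h'⟩ | ⟨hy', hz, ⟨u', v'⟩, huv', hu', hv'⟩)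
    · exact Or.inl ⟨hx, hz, htrans _ _ _ h h'⟩
    · exact (hy hy').elim
    · exact (hy' hy).elim
    · refine Or.inr ⟨hx, hz, (u, v'), ?_, hu, hv'⟩
      have : v = u' := hB.left_unique hv hu'
      subst this
      exact Eq.trans huv huv')
  refine ⟨a, ha, fun g x hgx => ?_⟩
  -- Uniqueness at the identity says that `K` relates `x` to no other point of its own class.
  exact (hKu 1 x).unique ⟨E.toSetoid.trans (ht.rel_one x) (E.toSetoid.symm hgx), (haK g x).2⟩
    ⟨ht.rel_one x, hK1 x⟩

/-! ### Joins with a subgroup and Borel orbit selectors -/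

namespace CBER

variable {X : Type*} [MeasurableSpace X]

/-- The restriction of a countable Borel equivalence relation to a subset. -/
def restrict (E : CBER X) (S : Set X) : CBER S where
  toSetoid := E.toSetoid.comap Subtype.val
  borel := E.measurableSet_rel (measurable_subtype_coe.comp measurable_fst)
    (measurable_subtype_coe.comp measurable_snd)
  countable_classes x := (E.countable_classes x.1).preimage Subtype.val_injective

namespace IsOuterRep

variable {G : Type*} [Group G] {E : CBER X} {b : G →* E.Out} {t : G → X → X}

/-- The join of `E` with the orbits of the outer action of a countable subgroup. -/
def join (ht : E.IsOuterRep b t) (N : Subgroup G) [Countable N] : CBER X where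
  r x y := ∃ n : N, E.toSetoid (t n x) y
  iseqv :=
    { refl := fun x => ⟨1, ht.rel_one x⟩
      symm := fun ⟨n, hn⟩ => ⟨n⁻¹, ht.rel_inv hn⟩
      trans := fun ⟨n, hn⟩ ⟨m, hm⟩ => ⟨m * n, E.toSetoid.trans (ht.rel_mul_of_rel hn) hm⟩ }
  borel := by
    have : {p : X × X | ∃ n : N, E.toSetoid (t n p.1) p.2} =
        ⋃ n : N, {p : X × X | E.toSetoid (t n p.1) p.2} := by
      ext p
      simp
    exact this ▸ MeasurableSet.iUnion fun n : N =>
      E.measurableSet_rel ((ht.measurable n).comp measurable_fst) measurable_snd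
  countable_classes x := by
    have : {y | ∃ n : N, E.toSetoid (t n x) y} = ⋃ n : N, {y | E.toSetoid (t n x) y} := by
      ext y
      simp
    exact this ▸ Set.countable_iUnion fun n : N => E.countable_classes (t n x)

variable {N : Subgroup G} [Countable N]

theorem join_of_rel (ht : E.IsOuterRep b t) {x y : X} (h : E.toSetoid x y) :
    (ht.join N).toSetoid x y :=
  ⟨1, E.toSetoid.trans (ht.rel_one x) h⟩

/-- Normality enters here: on classes, `g n = (g n g⁻¹) g`. -/
theorem join_map [N.Normal] (ht : E.IsOuterRep b t) (g : G) {x y : X}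
    (h : (ht.join N).toSetoid x y) : (ht.join N).toSetoid (t g x) (t g y) := by
  obtain ⟨n, hn⟩ := h
  refine ⟨⟨g * n * g⁻¹, Subgroup.Normal.conj_mem inferInstance _ n.2 g⟩, ?_⟩
  have h1 := ht.rel_mul (g * n * g⁻¹) g x
  rw [inv_mul_cancel_right] at h1
  exact E.toSetoid.trans h1 (ht.rel_mul_of_rel hn)

theorem rel_inv_apply (ht : E.IsOuterRep b t) (g : G) (x : X) :
    E.toSetoid (t g (t g⁻¹ x)) x := by
  have := ht.rel_mul g g⁻¹ x
  rw [mul_inv_cancel] at this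
  exact E.toSetoid.trans this (ht.rel_one x)

theorem join_map_inv_iff [N.Normal] (ht : E.IsOuterRep b t) (g : G) {x y : X} :
    (ht.join N).toSetoid x (t g⁻¹ y) ↔ (ht.join N).toSetoid (t g x) y := by
  constructor
  · intro h
    exact (ht.join N).toSetoid.trans (ht.join_map g h) (ht.join_of_rel (ht.rel_inv_apply g y))
  · intro h
    refine (ht.join N).toSetoid.trans (ht.join_of_rel ?_) (ht.join_map g⁻¹ h)
    exact E.toSetoid.symm (ht.rel_inv (E.toSetoid.refl _))

end IsOuterRep

/-- A Borel action of a finite group has a Borel selector of orbit representatives. -/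
theorem exists_orbit_selector [StandardBorelSpace X] {H : Type*} [Group H] [Finite H] {E : CBER X}
    (c : H →* E.Aut) : ∃ π : X → X, Measurable π ∧ (∀ x, ∃ h, (c h).1 x = π x) ∧
      ∀ h x, π ((c h).1 x) = π x := by
  let e := embeddingReal X
  have he : MeasurableEmbedding e := measurableEmbedding_embeddingReal X
  have hex : ∀ x, ∃ h, ∀ k, e ((c h).1 x) ≤ e ((c k).1 x) := fun x =>
    Finite.exists_min fun h => e ((c h).1 x)
  choose m hm using hex
  -- The least orbit point in a real coding does not depend on the choice of `m x`, so the graph of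
  -- the selector has a Borel description without `m`.
  have hu : ∀ x y, (∃ h, (c h).1 x = y) → (∀ k, e y ≤ e ((c k).1 x)) → (c (m x)).1 x = y := by
    rintro x _ ⟨h, rfl⟩ hy
    exact he.injective (le_antisymm (hm x h) (hy (m x)))
  refine ⟨fun x => (c (m x)).1 x, ?_, fun x => ⟨m x, rfl⟩, fun h x => ?_⟩
  · apply measurable_of_measurableSet_graph
    have : {p : X × X | (c (m p.1)).1 p.1 = p.2} = (⋃ h, {p : X × X | (c h).1 p.1 = p.2}) ∩
        ⋂ k, {p : X × X | e p.2 ≤ e ((c k).1 p.1)} := by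
      ext ⟨x, y⟩
      simp only [mem_ofPred_eq, mem_inter_iff, mem_iUnion, mem_iInter]
      refine ⟨fun h => ⟨⟨_, h⟩, fun k => ?_⟩, fun h => hu x y h.1 h.2⟩
      rw [← h]
      exact hm x k
    rw [this]
    refine (MeasurableSet.iUnion fun h => ?_).inter (MeasurableSet.iInter fun k => ?_)
    · exact measurableSet_eq_fun ((c h).2.1.comp measurable_fst) measurable_snd
    · exact measurableSet_le (he.measurable.comp measurable_snd)
        (he.measurable.comp ((c k).2.1.comp measurable_fst))
  · have hmul : ∀ k, (c k).1 ((c h).1 x) = (c (k * h)).1 x := fun k => by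
      rw [map_mul]
      rfl
    refine (hu x _ ⟨m ((c h).1 x) * h, (hmul _).symm⟩ fun k => ?_).symm
    have := hm ((c h).1 x) (k * h⁻¹)
    rwa [hmul (k * h⁻¹), inv_mul_cancel_right] at this

end CBER

/-! ### Descending to the space of `N`-orbits -/

namespace CBER

variable {X : Type*} [MeasurableSpace X] {G : Type*} [Group G]
  {E : CBER X} {b : G →* E.Out} {t : G → X → X} {N : Subgroup G} {c : N →* E.Aut} {π : X → X}

/-- Equal selector values put `x` and `y` in one `N`-orbit, and class-bijectivity forbids two points
of an orbit in one `E`-class. -/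
theorem eq_of_rel_of_selector_eq (hcb : E.IsClassBijective c) (hπ : ∀ x, ∃ h, (c h).1 x = π x)
    {x y : X} (hxy : E.toSetoid x y) (h : π x = π y) : x = y := by
  obtain ⟨n, hn⟩ := hπ x
  obtain ⟨m, hm⟩ := hπ y
  have hyx : (c (m⁻¹ * n)).1 x = y := by
    have : (c (m⁻¹ * n)).1 x = (c m).1.symm ((c n).1 x) := by
      rw [map_mul, map_inv]
      rfl
    rw [this, hn, h, ← hm, Equiv.symm_apply_apply]
  have := hcb (m⁻¹ * n) x (hyx.symm ▸ E.toSetoid.symm hxy)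
  rw [← this, hyx]

theorem selector_selector (hπ : ∀ x, ∃ h, (c h).1 x = π x) (hπc : ∀ h x, π ((c h).1 x) = π x)
    (x : X) : π (π x) = π x := by
  obtain ⟨h, hh⟩ := hπ x
  rw [← hh, hπc, hh]

namespace IsOuterRep

variable [Countable N]

theorem join_apply (ht : E.IsOuterRep b t) (hc : ∀ (n : N) x, E.toSetoid (t n x) ((c n).1 x))
    (n : N) (x : X) : (ht.join N).toSetoid x ((c n).1 x) :=
  ⟨n, hc n x⟩

theorem join_selector (ht : E.IsOuterRep b t) (hc : ∀ (n : N) x, E.toSetoid (t n x) ((c n).1 x))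
    (hπ : ∀ x, ∃ h, (c h).1 x = π x) (x : X) : (ht.join N).toSetoid x (π x) := by
  obtain ⟨h, hh⟩ := hπ x
  exact hh ▸ ht.join_apply hc h x

/-- Every orbit of a class-bijective action of `N` meets each `E`-class in its join class in exactly
one point. -/
theorem existsUnique_rel_selector_eq (ht : E.IsOuterRep b t)
    (hc : ∀ (n : N) x, E.toSetoid (t n x) ((c n).1 x)) (hcb : E.IsClassBijective c)
    (hπ : ∀ x, ∃ h, (c h).1 x = π x) (hπc : ∀ h x, π ((c h).1 x) = π x) {x z : X} (hz : π z = z)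
    (hxz : (ht.join N).toSetoid x z) : ∃! y, E.toSetoid x y ∧ π y = z := by
  obtain ⟨n, hn⟩ := (ht.join N).toSetoid.symm hxz
  refine ⟨(c n).1 z, ⟨E.toSetoid.trans (E.toSetoid.symm hn) (hc n z), (hπc n z).trans hz⟩, ?_⟩
  rintro y ⟨hxy, hy⟩
  refine eq_of_rel_of_selector_eq hcb hπ ?_ (hy.trans ((hπc n z).trans hz).symm)
  exact E.toSetoid.trans (E.toSetoid.symm hxy) (E.toSetoid.trans (E.toSetoid.symm hn) (hc n z))

variable [StandardBorelSpace X]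

/-- The outer action of `G` on `X` descends to Borel automorphisms of the space of orbits of the
finite normal subgroup `N`. -/
theorem exists_aut_restrict [N.Normal] [Finite N] (ht : E.IsOuterRep b t)
    (hc : ∀ (n : N) x, E.toSetoid (t n x) ((c n).1 x)) (hcb : E.IsClassBijective c)
    (hπm : Measurable π) (hπ : ∀ x, ∃ h, (c h).1 x = π x) (hπc : ∀ h x, π ((c h).1 x) = π x)
    (g : G) : ∃ T : ((ht.join N).restrict {x | π x = x}).Aut,
      ∀ z, (ht.join N).toSetoid (t g z.1) (T.1 z).1 := by
  classical
  let F := ht.join N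
  let Y : Set X := {x | π x = x}
  have hY : MeasurableSet Y := measurableSet_eq_fun hπm measurable_id
  have := hY.standardBorel
  let pr : X → Y := fun x => ⟨π x, selector_selector hπ hπc x⟩
  have hprm : Measurable pr := hπm.subtype_mk
  have hprs : Function.Surjective pr := fun z => ⟨z.1, Subtype.ext z.2⟩
  have hpre : ∀ {x y}, pr x = y ↔ π x = y.1 := fun {x y} => Subtype.ext_iff
  let q : Y → Quotient F.toSetoid := fun z => Quotient.mk _ z.1
  let r : Y → Quotient F.toSetoid := fun w => Quotient.mk _ (t g⁻¹ w.1)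
  have hmk := F.borelOver_mk
  have hqc : ∀ d, (q ⁻¹' {d}).Countable := fun d =>
    (hmk.countable_left d).preimage Subtype.val_injective
  have hrc : ∀ d, (r ⁻¹' {d}).Countable := fun d =>
    (hmk.countable_left d).preimage ((ht.bijective g⁻¹).1.comp Subtype.val_injective)
  have hqm : Measurable fun z : Y => z.1 := measurable_subtype_coe
  have hrm : Measurable fun w : Y => t g⁻¹ w.1 := (ht.measurable _).comp measurable_subtype_coe
  have hover : ∀ {f h : Y → X}, Measurable f → Measurable h →
      MeasurableSet {p : Y × Y | Quotient.mk F.toSetoid (f p.1) = Quotient.mk _ (h p.2)} := by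
    intro f h hf hh
    exact ((hf.comp measurable_fst).prodMk (hh.comp measurable_snd)) hmk.borel
  have hFπ : ∀ x, F.toSetoid x (π x) := ht.join_selector hc hπ
  obtain ⟨m, ⟨o⟩⟩ := Finite.exists_equiv_fin N
  -- Points of an orbit are numbered by the least label of an element of `N` carrying the
  -- representative to them; this bounds the fibres of `pr` by the order of `N`.
  have hidx : ∀ x, ∃ i, ∃ n : N, (o n : ℕ) = i ∧ (c n).1 (π x) = x := by
    intro x
    obtain ⟨n, hn⟩ := hπ x
    refine ⟨_, n⁻¹, rfl, ?_⟩
    rw [← hn, map_inv]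
    exact (c n).1.symm_apply_apply x
  let idx : X → ℕ := fun x => Nat.find (hidx x)
  have hidxm : Measurable idx := by
    refine measurable_find hidx fun i => ?_
    have : {x | ∃ n : N, (o n : ℕ) = i ∧ (c n).1 (π x) = x} =
        ⋃ n : N, ⋃ (_ : (o n : ℕ) = i), {x | (c n).1 (π x) = x} := by
      ext x
      simp
    rw [this]
    exact MeasurableSet.iUnion fun n => MeasurableSet.iUnion fun _ =>
      measurableSet_eq_fun ((c n).2.1.comp hπm) measurable_id
  have hlt : ∀ x, idx x < m := by
    intro x
    obtain ⟨n, hn, -⟩ := Nat.find_spec (hidx x)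
    exact hn.symm.trans_lt (o n).2
  have hinj : ∀ x y, pr x = pr y → idx x = idx y → x = y := by
    intro x y hxy hi
    obtain ⟨n, hn, hnx⟩ := Nat.find_spec (hidx x)
    obtain ⟨k, hk, hky⟩ := Nat.find_spec (hidx y)
    have hnk : n = k := o.injective (Fin.ext (hn.trans (hi.trans hk.symm)))
    have hπxy : π x = π y := congrArg Subtype.val hxy
    rw [← hnx, ← hky, hnk, hπxy]
  -- Twisting `r` by `t g⁻¹` means that a bijection over the base sends `z` into the join class of
  -- `t g z`.
  obtain ⟨M, hM, hMt⟩ := exists_bijective_matching (Z := Y) (W := Y) (X := X) (q := q) (r := r)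
    (π₁ := pr) (π₂ := fun x => pr (t g x)) (idx₁ := idx) (idx₂ := fun x => idx (t g x)) (n := m)
    ⟨hover hqm hqm, hqc, hqc⟩ ⟨hover hrm hrm, hrc, hrc⟩ ⟨hover hqm hrm, hqc, hrc⟩
    hprm (hprm.comp (ht.measurable g)) hprs (hprs.comp (ht.bijective g).2)
    (fun x => Quotient.sound <| F.toSetoid.trans (F.toSetoid.symm (hFπ x))
      ((ht.join_map_inv_iff g).2 (hFπ _)))
    hidxm (hidxm.comp (ht.measurable g)) hlt (fun x => hlt _) hinj
    (fun x y h h' => (ht.bijective g).1 (hinj _ _ h h')) E.borel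
    (fun x z hz => by
      have hz' : F.toSetoid z.1 (π x) := Quotient.exact hz
      obtain ⟨y, hy, hyu⟩ := ht.existsUnique_rel_selector_eq hc hcb hπ hπc z.2
        (F.toSetoid.trans (hFπ x) (F.toSetoid.symm hz'))
      exact ⟨y, ⟨hpre.2 hy.2, hy.1⟩, fun y' hy' => hyu y' ⟨hy'.2, hpre.1 hy'.1⟩⟩)
    (fun x w hw => by
      have hw' : F.toSetoid (t g⁻¹ w.1) (π x) := Quotient.exact hw
      have hxw : F.toSetoid (t g x) w.1 := (ht.join_map_inv_iff g).1
        (F.toSetoid.trans (hFπ x) (F.toSetoid.symm hw'))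
      obtain ⟨y, hy, hyu⟩ := ht.existsUnique_rel_selector_eq hc hcb hπ hπc w.2 hxw
      obtain ⟨a, rfl⟩ := (ht.bijective g).2 y
      refine ⟨a, ⟨hpre.2 hy.2, E.toSetoid.symm ((ht.rel_iff g).2 hy.1)⟩, fun a' ha' => ?_⟩
      exact (ht.bijective g).1 (hyu _ ⟨(ht.rel_iff g).1 (E.toSetoid.symm ha'.2), hpre.1 ha'.1⟩))
  choose f hf using fun z => (hMt (q z)).1 z rfl
  choose f' hf' using fun w => (hMt (r w)).2 w rfl
  let P : Equiv.Perm Y := ⟨f, f', fun z => hM.left_unique (hf' _) (hf z),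
    fun w => hM.right_unique (hf _) (hf' w)⟩
  have hPg : ∀ z, F.toSetoid (t g z.1) (P z).1 := fun z =>
    (ht.join_map_inv_iff g).1 (Quotient.exact (hM.fibre_eq (hf z)))
  have hfm : Measurable f := by
    apply measurable_of_measurableSet_graph
    convert hM.measurableSet using 1
    ext ⟨z, w⟩
    refine ⟨fun h => ?_, fun h => hM.right_unique (hf z) h⟩
    have h' : f z = w := h
    exact h' ▸ hf z
  have hfm' : Measurable f' := by
    apply measurable_of_measurableSet_graph
    convert measurable_swap hM.measurableSet using 1
    ext ⟨w, z⟩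
    refine ⟨fun h => ?_, fun h => hM.left_unique (hf' w) h⟩
    have h' : f' w = z := h
    exact h' ▸ hf' w
  refine ⟨⟨P, hfm, hfm', fun z z' => ⟨fun h => ?_, fun h => ?_⟩⟩, hPg⟩
  · exact F.toSetoid.trans (F.toSetoid.symm (hPg z)) (F.toSetoid.trans (ht.join_map g h) (hPg z'))
  · have h1 : F.toSetoid (t g z.1) (t g z'.1) :=
      F.toSetoid.trans (hPg z) (F.toSetoid.trans h (F.toSetoid.symm (hPg z')))
    refine F.toSetoid.trans ((ht.join_map_inv_iff g).2 h1) (ht.join_of_rel ?_)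
    exact ht.rel_inv (E.toSetoid.refl _)

end IsOuterRep

end CBER

/-- The inclusion of a finite normal subgroup has the class-bijective lifting property as soon as
every outer action of the quotient has a class-bijective lift. -/
theorem hasClassBijectiveLiftingProperty_subtype (G : Type v) [Group G] (N : Subgroup G)
    [N.Normal] [Finite N] (hN : EveryOuterActionHasClassBijectiveLift.{u, v} (G ⧸ N)) :
    HasClassBijectiveLiftingProperty.{u, v, v} N.subtype := by
  intro X _ _ E c b hcomm hcb
  obtain ⟨t, ht⟩ := E.exists_isOuterRep b
  have hc : ∀ (n : N) x, E.toSetoid (t n x) ((c n).1 x) := fun n =>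
    (ht.toOut_eq_iff (c n) n).1 (DFunLike.congr_fun hcomm n)
  obtain ⟨π, hπm, hπ, hπc⟩ := CBER.exists_orbit_selector c
  have hππ := CBER.selector_selector hπ hπc
  let Y : Set X := {x | π x = x}
  have hY : MeasurableSet Y := measurableSet_eq_fun hπm measurable_id
  have := hY.standardBorel
  let F := ht.join N
  let E' : CBER Y := F.restrict Y
  have hFπ : ∀ x, F.toSetoid x (π x) := ht.join_selector hc hπ
  choose T hT using ht.exists_aut_restrict hc hcb hπm hπ hπc
  have hTeq : ∀ (S : E'.Aut) g, E'.toOut S = E'.toOut (T g) ↔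
      ∀ z, F.toSetoid (t g z.1) (S.1 z).1 := by
    intro S g
    rw [CBER.toOut_eq_toOut_iff]
    exact forall_congr' fun z => ⟨fun h => F.toSetoid.trans (hT g z) h,
      fun h => F.toSetoid.trans (F.toSetoid.symm (hT g z)) h⟩
  let b₀ : G →* E'.Out := MonoidHom.mk' (fun g => E'.toOut (T g)) fun g h => by
    rw [← map_mul]
    refine ((hTeq _ _).2 fun z => ?_).symm
    exact F.toSetoid.trans (F.toSetoid.symm (ht.join_of_rel (ht.rel_mul g h z.1)))
      (F.toSetoid.trans (ht.join_map g (hT h z)) (hT g _))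
  -- Elements of `N` preserve every join class, so `b₀` kills them.
  let b' : G ⧸ N →* E'.Out := QuotientGroup.lift N b₀ fun n hn => by
    show E'.toOut (T n) = 1
    rw [← map_one E'.toOut]
    exact ((hTeq 1 n).2 fun z => F.toSetoid.symm ⟨⟨n, hn⟩, E.toSetoid.refl _⟩).symm
  obtain ⟨a', ha', hcb'⟩ := hN Y E' b'
  have ha'T : ∀ (g : G) z, F.toSetoid (t g z.1) ((a' (g : G ⧸ N)).1 z).1 := fun g =>
    (hTeq _ g).1 (DFunLike.congr_fun ha' (g : G ⧸ N))
  let pr : X → Y := fun x => ⟨π x, hππ x⟩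
  have hprm : Measurable pr := hπm.subtype_mk
  -- The image of `x` under `g` is the unique point of the class of `t g x` lying in the orbit that
  -- `a'` assigns to the orbit of `x`.
  let K : G → Set (X × X) := fun g => {p | (a' (g : G ⧸ N)).1 (pr p.1) = pr p.2}
  have hK : ∀ g, MeasurableSet (K g) := fun g =>
    measurableSet_eq_fun ((a' g).2.1.comp (hprm.comp measurable_fst)) (hprm.comp measurable_snd)
  have hKu : ∀ g x, ∃! y, E.toSetoid (t g x) y ∧ (x, y) ∈ K g := by
    intro g x
    have h1 : F.toSetoid (t g x) ((a' (g : G ⧸ N)).1 (pr x)).1 :=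
      F.toSetoid.trans (ht.join_map g (hFπ x)) (ha'T g (pr x))
    obtain ⟨y, hy, hyu⟩ := ht.existsUnique_rel_selector_eq hc hcb hπ hπc
      ((a' (g : G ⧸ N)).1 (pr x)).2 h1
    exact ⟨y, ⟨hy.1, Subtype.ext hy.2.symm⟩,
      fun y' hy' => hyu y' ⟨hy'.1, (congrArg Subtype.val hy'.2).symm⟩⟩
  obtain ⟨a, ha, haK⟩ := ht.exists_lift hK hKu (fun x => by
    show (a' ((1 : G) : G ⧸ N)).1 (pr x) = pr x
    rw [QuotientGroup.mk_one, map_one]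
    rfl) (fun g h x y z hxy hyz => by
    have hxy' : (a' (h : G ⧸ N)).1 (pr x) = pr y := hxy
    have hyz' : (a' (g : G ⧸ N)).1 (pr y) = pr z := hyz
    show (a' ((g * h : G) : G ⧸ N)).1 (pr x) = pr z
    rw [QuotientGroup.mk_mul, map_mul, ← hyz', ← hxy']
    rfl)
  refine ⟨a, ?_, ha, ?_⟩
  · ext n x
    refine (hKu n x).unique (haK n x) ⟨hc n x, ?_⟩
    show (a' ((n : G) : G ⧸ N)).1 (pr x) = pr ((c n).1 x)
    rw [(QuotientGroup.eq_one_iff (n : G)).2 n.2, map_one]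
    exact Subtype.ext (hπc n x).symm
  · intro g x hgx
    have h1 : (a' (g : G ⧸ N)).1 (pr x) = pr ((a g).1 x) := (haK g x).2
    -- If `g` fixes the `E`-class of `x`, class-bijectivity of `a'` shows that it fixes the
    -- `N`-orbit of `x`; class and orbit together determine `x`.
    have h2 : (a' (g : G ⧸ N)).1 (pr x) = pr x := by
      refine hcb' _ _ ?_
      rw [h1]
      exact F.toSetoid.trans (F.toSetoid.symm (hFπ _))
        (F.toSetoid.trans (ht.join_of_rel hgx) (hFπ x))
    exact CBER.eq_of_rel_of_selector_eq hcb hπ hgx (congrArg Subtype.val (h1.symm.trans h2))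

theorem mainTheorem10 (G : Type v) [Group G] [Countable G]
    (N : Subgroup G) [N.Normal] [Finite N]
    (hN : EveryOuterActionHasClassBijectiveLift.{u, v} (G ⧸ N)) :
    HasClassBijectiveLiftingProperty.{u, v, v} N.subtype ∧
      EveryOuterActionHasClassBijectiveLift.{u, v} G := by
  have h := hasClassBijectiveLiftingProperty_subtype G N hN
  refine ⟨h, fun X _ _ E b => ?_⟩
  obtain ⟨c, hc, hcb⟩ := E.exists_classBijective_lift_of_finite (b.comp N.subtype)
  obtain ⟨a, -, ha, hab⟩ := h X E c b hc hcb
  exact ⟨a, ha, hab⟩
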